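/- Work over $\mathbb{C}$. Let $\mathfrak g=\mathfrak{gl}(1|2)$ be the Lie superalgebra of $3\times 3$ complex matrices with one even and two odd indices (so the matrix unit $E_{ij}$ has parity $|i|+|j|$, where $|1|=0$, $|2|=|3|=1$), with bracket $[X,Y]=XY-(-1)^{|X||Y|}YX$ on homogeneous elements, and let $U(\mathfrak g)$ be its universal enveloping algebra. Let $\mathfrak k=\mathfrak{osp}(1|2)\subseteq\mathfrak g$ be the subalgebra of fixed points of the involution $\theta(X)=-PX^{\mathrm{st}}P^{-1}$, where $$P=\begin{bmatrix}1&0&0\\0&0&1\\0&-1&0\end{bmatrix},\qquad \begin{bmatrix}A&B\\C&D\end{bmatrix}^{\mathrm{st}}=\begin{bmatrix}A^{T}&-C^{T}\\B^{T}&D^{T}\end{bmatrix};$$ explicitly, $\mathfrak k$ consists of the matrices $\begin{bmatrix}0&x&y\\-y&u&v\\x&w&-u\end{bmatrix}$ with $x,y,u,v,w\in\mathbb{C}$. Let $\mathcal I=\mathfrak kU(\mathfrak g)+U(\mathfrak g)\mathfrak k$. In $\mathfrak g$ put $$z=\begin{bmatrix}1&0&0\\0&1&0\\0&0&1\end{bmatrix},\quad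 k=\begin{bmatrix}0&0&0\\0&1&0\\0&0&-1\end{bmatrix},\quad k_1=\begin{bmatrix}0&0&0\\0&0&1\\0&0&0\end{bmatrix},\quad k_2=\begin{bmatrix}0&0&0\\0&0&0\\0&1&0\end{bmatrix},$$ $$e'=\begin{bmatrix}0&1&0\\0&0&0\\1&0&0\end{bmatrix},\quad f'=\begin{bmatrix}0&0&1\\-1&0&0\\0&0&0\end{bmatrix},\quad p=\begin{bmatrix}2&0&0\\0&1&0\\0&0&1\end{bmatrix},\quad e=\begin{bmatrix}0&1&0\\0&0&0\\-1&0&0\end{bmatrix},\quad f=\begin{bmatrix}0&0&1\\1&0&0\\0&0&0\end{bmatrix},$$ and for $v=(a,b)\in\mathbb{C}^2$ put $$v_{\mathfrak k}=\begin{bmatrix}0&a&b\\-b&0&0\\a&0&0\end{bmatrix}\in\mathfrak k,\qquad v_{\mathfrak p}=\begin{bmatrix}0&a&b\\b&0&0\\-a&0&0\end{bmatrix}.$$ There are unique sequences of polynomials $(\alpha_n)_{n\ge 0}$ and $(\beta_{n-1})_{n\ge 0}$ in $\mathbb{C}[x]$ such that, in $U(\mathfrak g)$, $$p^nv_{\mathfrak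 k}=v_{\mathfrak k}\,\alpha_n(p)+\beta_{n-1}(p)\,v_{\mathfrak p}\qquad\text{for all } n\ge 0 \text{ and } v\in\mathbb{C}^2$$ (the case $n=0$ gives $\beta_{-1}=0$). With these polynomials, the following vectors together form a basis of $\mathcal I$: (i) $z^mp^ne$ and $z^mp^nf$, where $m,n\ge 0$; (ii) $z^m\beta_{n-1}(p)ef-z^mp^{n+1}$, where $m,n\ge 0$; (iii) $z^mk^{r_1}k_1^{r_2}k_2^{r_3}(e')^{r_4}(f')^{r_5}p^{s_1}e^{s_2}f^{s_3}$, where $m,r_1,r_2,r_3,s_1\ge 0$, $r_4,r_5,s_2,s_3\in\{0,1\}$, and at least one of $r_1,\dots,r_5$ is $\ge 1$. -/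

import Mathlib

open Polynomial

/-- The Koszul sign `(-1) ^ (a b)` of two parities. -/
def koszul (a b : ZMod 2) : ℂ := (-1) ^ (a.val * b.val)

/-- A complex Lie superalgebra on the vector space `g`: a `ℤ/2`-grading and an even bilinear bracket
that is super skew-symmetric and satisfies the super Jacobi identity. -/
structure LieSuperalgebra (g : Type*) [AddCommGroup g] [Module ℂ g] where
  /-- the homogeneous subspace of the given parity -/
  part : ZMod 2 → Submodule ℂ g
  isCompl : IsCompl (part 0) (part 1)
  /-- the superbracket -/
  bracket : g →ₗ[ℂ] g →ₗ[ℂ] g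
  bracket_mem : ∀ {a b : ZMod 2} {x y : g}, x ∈ part a → y ∈ part b → bracket x y ∈ part (a + b)
  skew : ∀ {a b : ZMod 2} {x y : g}, x ∈ part a → y ∈ part b →
    bracket x y = -(koszul a b • bracket y x)
  jacobi : ∀ {a b c : ZMod 2} {x y w : g}, x ∈ part a → y ∈ part b → w ∈ part c →
    bracket x (bracket y w) = bracket (bracket x y) w + koszul a b • bracket y (bracket x w)

namespace LieSuperalgebra

section general

variable {g : Type*} [AddCommGroup g] [Module ℂ g] (L : LieSuperalgebra g)

/-- The defining relations `x y = (-1)^(|x||y|) y x + [x, y]`, for homogeneous `x, y`, of the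
universal enveloping algebra. -/
inductive Rel : TensorAlgebra ℂ g → TensorAlgebra ℂ g → Prop
  | mk {a b : ZMod 2} {x y : g} (hx : x ∈ L.part a) (hy : y ∈ L.part b) :
      Rel (TensorAlgebra.ι ℂ x * TensorAlgebra.ι ℂ y)
        (koszul a b • (TensorAlgebra.ι ℂ y * TensorAlgebra.ι ℂ x)
          + TensorAlgebra.ι ℂ (L.bracket x y))

/-- The universal enveloping algebra `U(g)`: the tensor algebra modulo the relations `Rel`. -/
def U : Type _ := RingQuot L.Rel

noncomputable instance : Ring L.U := inferInstanceAs (Ring (RingQuot L.Rel))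

noncomputable instance : Algebra ℂ L.U := inferInstanceAs (Algebra ℂ (RingQuot L.Rel))

/-- The canonical map `g → U(g)`. -/
noncomputable def ι : g →ₗ[ℂ] L.U :=
  (RingQuot.mkAlgHom ℂ L.Rel).toLinearMap ∘ₗ TensorAlgebra.ι ℂ

/-- A (graded) subalgebra of a Lie superalgebra. -/
structure Subalgebra extends Submodule ℂ g where
  graded : ∀ x ∈ toSubmodule, ∃ x₀ ∈ toSubmodule ⊓ L.part 0, ∃ x₁ ∈ toSubmodule ⊓ L.part 1,
    x = x₀ + x₁
  bracket_mem : ∀ x ∈ toSubmodule, ∀ y ∈ toSubmodule, L.bracket x y ∈ toSubmodule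

/-- The subspace `k U(g) + U(g) k` of `U(g)` (a product of subspaces is the span of the products). -/
noncomputable def biIdeal {L : LieSuperalgebra g} (k : L.Subalgebra) : Submodule ℂ L.U :=
  (k.toSubmodule.map L.ι) * ⊤ ⊔ ⊤ * (k.toSubmodule.map L.ι)

end general

section gl

variable {I : Type*} (par : I → ZMod 2)

/-- Matrices of parity `d`: the matrix unit `E i j` has parity `|i| + |j|`. -/
def glPart (d : ZMod 2) : Submodule ℂ (Matrix I I ℂ) where
  carrier := {X | ∀ i j, par i + par j ≠ d → X i j = 0}
  zero_mem' := by simp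
  add_mem' := by
    intro X Y hX hY i j h
    simp [hX i j h, hY i j h]
  smul_mem' := by
    intro c X hX i j h
    simp [hX i j h]

/-- The component of parity `d` of a matrix. -/
def glProj (d : ZMod 2) : Matrix I I ℂ →ₗ[ℂ] Matrix I I ℂ where
  toFun X := Matrix.of fun i j => if par i + par j = d then X i j else 0
  map_add' X Y := by
    ext i j
    by_cases h : par i + par j = d <;> simp [h]
  map_smul' c X := by
    ext i j
    by_cases h : par i + par j = d <;> simp [h]

theorem glProj_mem (d : ZMod 2) (X : Matrix I I ℂ) : glProj par d X ∈ glPart par d := by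
  intro i j h
  simp [glProj, h]

theorem glProj_self {d : ZMod 2} {X : Matrix I I ℂ} (hX : X ∈ glPart par d) :
    glProj par d X = X := by
  ext i j
  by_cases h : par i + par j = d
  · simp [glProj, h]
  · simp [glProj, h, hX i j h]

theorem glProj_ne {d d' : ZMod 2} (hd : d' ≠ d) {X : Matrix I I ℂ} (hX : X ∈ glPart par d) :
    glProj par d' X = 0 := by
  ext i j
  by_cases h : par i + par j = d'
  · simp [glProj, h, hX i j (by rw [h]; exact hd)]
  · simp [glProj, h]

variable [Fintype I]

theorem glPart_mul {a b : ZMod 2} {X Y : Matrix I I ℂ} (hX : X ∈ glPart par a)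
    (hY : Y ∈ glPart par b) : X * Y ∈ glPart par (a + b) := by
  intro i j h
  rw [Matrix.mul_apply]
  refine Finset.sum_eq_zero fun l _ => ?_
  by_cases h1 : par i + par l = a
  · by_cases h2 : par l + par j = b
    · exfalso
      apply h
      rw [← h1, ← h2]
      generalize par i = u
      generalize par l = v
      generalize par j = w
      revert u v w
      decide
    · simp [hY l j h2]
  · simp [hX i l h1]

/-- The superbracket of matrices: the bilinear map with `[X, Y] = X Y - (-1)^(|X||Y|) Y X` for
homogeneous `X, Y`. -/
noncomputable def glBracket : Matrix I I ℂ →ₗ[ℂ] Matrix I I ℂ →ₗ[ℂ] Matrix I I ℂ :=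
  LinearMap.mk₂ ℂ
    (fun X Y => X * Y - ∑ a, ∑ b, koszul a b • (glProj par b Y * glProj par a X))
    (by intros; simp only [map_add, add_mul, mul_add, smul_add, Finset.sum_add_distrib]; abel)
    (by
      intro c X Y
      simp only [map_smul, Matrix.smul_mul, Matrix.mul_smul, smul_sub, Finset.smul_sum]
      simp only [smul_comm c])
    (by intros; simp only [map_add, add_mul, mul_add, smul_add, Finset.sum_add_distrib]; abel)
    (by
      intro c X Y
      simp only [map_smul, Matrix.smul_mul, Matrix.mul_smul, smul_sub, Finset.smul_sum]
      simp only [smul_comm c])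

theorem glBracket_apply {a b : ZMod 2} {X Y : Matrix I I ℂ} (hX : X ∈ glPart par a)
    (hY : Y ∈ glPart par b) : glBracket par X Y = X * Y - koszul a b • (Y * X) := by
  simp only [glBracket, LinearMap.mk₂_apply]
  congr 1
  rw [Finset.sum_eq_single a, Finset.sum_eq_single b, glProj_self par hX, glProj_self par hY]
  · intro d _ hd
    simp [glProj_ne par hd hY]
  · simp
  · intro d _ hd
    simp [glProj_ne par hd hX]
  · simp

/-- The general linear Lie superalgebra of the super vector space with basis `I` and parities `par`. -/
noncomputable def gl : LieSuperalgebra (Matrix I I ℂ) where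
  part := glPart par
  isCompl := by
    constructor
    · rw [Submodule.disjoint_def]
      intro X h0 h1
      rw [← glProj_self par h0]
      exact glProj_ne par (by decide) h1
    · rw [codisjoint_iff, eq_top_iff]
      intro X _
      have : X = glProj par 0 X + glProj par 1 X := by
        ext i j
        have h : ∀ d : ZMod 2, d = 0 ∨ d = 1 := by decide
        rcases h (par i + par j) with h | h <;> simp [glProj, h]
      rw [this]
      exact Submodule.add_mem_sup (glProj_mem par 0 X) (glProj_mem par 1 X)
  bracket := glBracket par
  bracket_mem := by
    intro a b X Y hX hY
    rw [glBracket_apply par hX hY]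
    refine Submodule.sub_mem _ (glPart_mul par hX hY) (Submodule.smul_mem _ _ ?_)
    rw [add_comm]
    exact glPart_mul par hY hX
  skew := by
    intro a b X Y hX hY
    rw [glBracket_apply par hX hY, glBracket_apply par hY hX, smul_sub, smul_smul]
    have h : koszul a b * koszul b a = 1 := by
      rw [koszul, koszul, mul_comm b.val, ← pow_add, ← two_mul, pow_mul]
      simp
    rw [h, one_smul, neg_sub]
  jacobi := by
    intro a b c X Y W hX hY hW
    have mem : ∀ {a b : ZMod 2} {X Y : Matrix I I ℂ}, X ∈ glPart par a → Y ∈ glPart par b →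
        X * Y - koszul a b • (Y * X) ∈ glPart par (a + b) := by
      intro a b X Y hX hY
      refine Submodule.sub_mem _ (glPart_mul par hX hY) (Submodule.smul_mem _ _ ?_)
      rw [add_comm]
      exact glPart_mul par hY hX
    rw [glBracket_apply par hY hW, glBracket_apply par hX hY, glBracket_apply par hX hW,
      glBracket_apply par hX (mem hY hW), glBracket_apply par (mem hX hY) hW,
      glBracket_apply par hY (mem hX hW)]
    have h : ∀ d : ZMod 2, d = 0 ∨ d = 1 := by decide
    have h11 : (1 : ZMod 2) + 1 = 0 := by decide
    have k00 : koszul 0 0 = 1 := by simp [koszul]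
    have k01 : koszul 0 1 = 1 := by simp [koszul]
    have k10 : koszul 1 0 = 1 := by simp [koszul]
    have k11 : koszul 1 1 = -1 := by simp [koszul, ZMod.val_one]
    rcases h a with rfl | rfl <;> rcases h b with rfl | rfl <;> rcases h c with rfl | rfl <;>
      simp only [add_zero, zero_add, h11, k00, k01, k10, k11, one_smul, neg_smul] <;> noncomm_ring

end gl

end LieSuperalgebra

/-! The pair `(gl(1|2), osp(1|2))`. -/

namespace GL12

/-- One even index and two odd indices. -/
def par : Fin 3 → ZMod 2 := ![0, 1, 1]

/-- The Lie superalgebra `gl(1|2)`. -/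
noncomputable def gl12 : LieSuperalgebra (Matrix (Fin 3) (Fin 3) ℂ) := LieSuperalgebra.gl par

/-- The supertranspose `[[A, B], [C, D]] ↦ [[Aᵀ, -Cᵀ], [Bᵀ, Dᵀ]]`. -/
noncomputable def superTranspose (X : Matrix (Fin 3) (Fin 3) ℂ) : Matrix (Fin 3) (Fin 3) ℂ :=
  Matrix.of fun i j => (if par i = 0 ∧ par j = 1 then -1 else 1) * X j i

/-- The matrix of the supersymmetric form that is preserved by `osp(1|2)`. -/
def P : Matrix (Fin 3) (Fin 3) ℂ := !![1, 0, 0; 0, 0, 1; 0, -1, 0]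

/-- The involution of `gl(1|2)` that defines the symmetric pair. -/
noncomputable def θ (X : Matrix (Fin 3) (Fin 3) ℂ) : Matrix (Fin 3) (Fin 3) ℂ :=
  -(P * superTranspose X * P⁻¹)

theorem P_inv : P⁻¹ = !![1, 0, 0; 0, 0, -1; 0, 1, 0] := by
  apply Matrix.inv_eq_right_inv
  ext i j
  fin_cases i <;> fin_cases j <;> simp [P, Matrix.mul_apply, Fin.sum_univ_three]

/-- The fixed points of `θ` are the matrices
`[[0, x, y], [-y, u, v], [x, w, -u]]`. -/
theorem θ_eq_iff (X : Matrix (Fin 3) (Fin 3) ℂ) :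
    θ X = X ↔ ∃ x y u v w : ℂ, X = !![0, x, y; -y, u, v; x, w, -u] := by
  have key : θ X = !![-X 0 0, X 2 0, -X 1 0; -X 0 2, -X 2 2, X 1 2; X 0 1, X 2 1, -X 1 1] := by
    have hst : superTranspose X =
        !![X 0 0, -X 1 0, -X 2 0; X 0 1, X 1 1, X 2 1; X 0 2, X 1 2, X 2 2] := by
      ext i j
      fin_cases i <;> fin_cases j <;> simp [superTranspose, par]
    rw [θ, P_inv, hst, P]
    ext i j
    fin_cases i <;> fin_cases j <;> simp
  rw [key]
  constructor
  · intro h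
    have h' : ∀ i j, _ = X i j := fun i j => congrFun (congrFun h i) j
    have e00 := h' 0 0
    have e01 := h' 0 1
    have e02 := h' 0 2
    have e22 := h' 2 2
    simp at e00 e01 e02 e22
    refine ⟨X 0 1, X 0 2, X 1 1, X 1 2, X 2 1, ?_⟩
    ext i j
    fin_cases i <;> fin_cases j <;> simp
    · linear_combination (-1 / 2 : ℂ) * e00
    · linear_combination -e02
    · exact e01
    · exact e22.symm
  · rintro ⟨x, y, u, v, w, rfl⟩
    ext i j
    fin_cases i <;> fin_cases j <;> simp

/-- The subalgebra `osp(1|2)` of `gl(1|2)`: the fixed points of `θ`. -/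
noncomputable def osp12 : gl12.Subalgebra where
  carrier := {X | θ X = X}
  zero_mem' := by
    change θ _ = _
    rw [θ_eq_iff]
    refine ⟨0, 0, 0, 0, 0, ?_⟩
    ext i j
    fin_cases i <;> fin_cases j <;> simp
  add_mem' := by
    intro X Y hX hY
    change θ X = X at hX
    change θ Y = Y at hY
    change θ _ = _
    rw [θ_eq_iff] at *
    obtain ⟨x, y, u, v, w, rfl⟩ := hX
    obtain ⟨x', y', u', v', w', rfl⟩ := hY
    refine ⟨x + x', y + y', u + u', v + v', w + w', ?_⟩
    ext i j
    fin_cases i <;> fin_cases j <;> simp [add_comm]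
  smul_mem' := by
    intro c X hX
    change θ X = X at hX
    change θ _ = _
    rw [θ_eq_iff] at *
    obtain ⟨x, y, u, v, w, rfl⟩ := hX
    refine ⟨c * x, c * y, c * u, c * v, c * w, ?_⟩
    ext i j
    fin_cases i <;> fin_cases j <;> simp
  graded := by
    intro X hX
    change θ X = X at hX
    obtain ⟨x, y, u, v, w, rfl⟩ := (θ_eq_iff X).1 hX
    refine ⟨!![0, 0, 0; 0, u, v; 0, w, -u], ⟨?_, ?_⟩, !![0, x, y; -y, 0, 0; x, 0, 0],
      ⟨?_, ?_⟩, ?_⟩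
    · change θ _ = _
      rw [θ_eq_iff]
      exact ⟨0, 0, u, v, w, by simp⟩
    · intro i j h
      revert h
      fin_cases i <;> fin_cases j <;> simp [par, (by decide : (1 : ZMod 2) + 1 = 0)]
    · change θ _ = _
      rw [θ_eq_iff]
      exact ⟨x, y, 0, 0, 0, by simp⟩
    · intro i j h
      revert h
      fin_cases i <;> fin_cases j <;> simp [par]
    · ext i j
      fin_cases i <;> fin_cases j <;> simp
  bracket_mem := by
    intro X hX Y hY
    change θ X = X at hX
    change θ Y = Y at hY
    change θ _ = _
    rw [θ_eq_iff] at *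
    obtain ⟨x, y, u, v, w, rfl⟩ := hX
    obtain ⟨x', y', u', v', w', rfl⟩ := hY
    have hs : (Finset.univ : Finset (ZMod 2)) = {0, 1} := by decide
    refine ⟨x * u' + y * w' - u * x' - w * y', x * v' - y * u' - v * x' + u * y',
      v * w' - v' * w - y * x' - y' * x, 2 * (u * v' - v * u') - 2 * y * y',
      2 * (w * u' - u * w') + 2 * x * x', ?_⟩
    simp only [gl12, LieSuperalgebra.gl, LieSuperalgebra.glBracket, LinearMap.mk₂_apply, hs]
    ext i j
    fin_cases i <;> fin_cases j <;>
      simp [koszul, ZMod.val_one, LieSuperalgebra.glProj, par, Matrix.mul_apply,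
        Fin.sum_univ_three, (by decide : (1 : ZMod 2) + 1 = 0)] <;> ring

/-- The image of a matrix in `U(gl(1|2))`. -/
noncomputable def inc (X : Matrix (Fin 3) (Fin 3) ℂ) : gl12.U := gl12.ι X

noncomputable def z : gl12.U := inc !![1, 0, 0; 0, 1, 0; 0, 0, 1]

noncomputable def k : gl12.U := inc !![0, 0, 0; 0, 1, 0; 0, 0, -1]

noncomputable def k₁ : gl12.U := inc !![0, 0, 0; 0, 0, 1; 0, 0, 0]

noncomputable def k₂ : gl12.U := inc !![0, 0, 0; 0, 0, 0; 0, 1, 0]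

noncomputable def e' : gl12.U := inc !![0, 1, 0; 0, 0, 0; 1, 0, 0]

noncomputable def f' : gl12.U := inc !![0, 0, 1; -1, 0, 0; 0, 0, 0]

noncomputable def p : gl12.U := inc !![2, 0, 0; 0, 1, 0; 0, 0, 1]

noncomputable def e : gl12.U := inc !![0, 1, 0; 0, 0, 0; -1, 0, 0]

noncomputable def f : gl12.U := inc !![0, 0, 1; 1, 0, 0; 0, 0, 0]

/-- The odd element of the `(-1)`-eigenspace of `θ` attached to `(a, b)`. -/
noncomputable def vP (a b : ℂ) : gl12.U := inc !![0, a, b; b, 0, 0; -a, 0, 0]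

/-- The odd element of `osp(1|2)` attached to `(a, b)`. -/
noncomputable def vK (a b : ℂ) : gl12.U := inc !![0, a, b; -b, 0, 0; a, 0, 0]

/-- The defining property of the polynomials `α n` and `β (n - 1)`, for all `n ≥ 0`. The second
sequence is shifted, so as to start with `β (-1)`: `β' n` stands for `β (n - 1)`. -/
def IsAlphaBeta (α β' : ℕ → ℂ[X]) : Prop :=
  ∀ (n : ℕ) (a b : ℂ), p ^ n * vK a b = vK a b * aeval p (α n) + aeval p (β' n) * vP a b

/-- Exponents of the PBW monomials of `U(gl(1|2))`. -/
structure PBWExponent where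
  (t r₁ r₂ r₃ : ℕ)
  (r₄ r₅ : Fin 2)
  (s₁ : ℕ)
  (s₂ s₃ : Fin 2)

/-- The PBW monomial with the given exponents. -/
noncomputable def pbw (x : PBWExponent) : gl12.U :=
  z ^ x.t * k ^ x.r₁ * k₁ ^ x.r₂ * k₂ ^ x.r₃ * e' ^ (x.r₄ : ℕ) * f' ^ (x.r₅ : ℕ)
    * p ^ x.s₁ * e ^ (x.s₂ : ℕ) * f ^ (x.s₃ : ℕ)

/-- The monomial has at least one factor from `osp(1|2)`. -/
def PBWExponent.HasK (x : PBWExponent) : Prop :=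
  1 ≤ x.r₁ ∨ 1 ≤ x.r₂ ∨ 1 ≤ x.r₃ ∨ 1 ≤ (x.r₄ : ℕ) ∨ 1 ≤ (x.r₅ : ℕ)

/-- Index type of the basis. -/
inductive BasisIndex where
  | pe (m n : ℕ)
  | pf (m n : ℕ)
  | beta (m n : ℕ)
  | mono (x : PBWExponent) (hx : x.HasK)

/-- The basis vectors; `β' n` stands for `β (n - 1)`. -/
noncomputable def basisVec (β' : ℕ → ℂ[X]) : BasisIndex → gl12.U
  | .pe m n => z ^ m * p ^ n * e
  | .pf m n => z ^ m * p ^ n * f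
  | .beta m n => z ^ m * aeval p (β' n) * e * f - z ^ m * p ^ (n + 1)
  | .mono x _ => pbw x

end GL12

/-! The engine is the Poincaré–Birkhoff–Witt theorem for Lie superalgebras, proved in the style of
Bergman's diamond lemma. Words in an ordered homogeneous basis are rewritten at out-of-order pairs,
a repeated odd letter counting as out of order. The rewriting terminates because the length, and
then the number of inversions, drops. It is confluent because the ambiguities resolve: disjoint ones
trivially, overlapping ones by the Jacobi identity (`defect_overlap`). So straightening factors
through `U(g)` and separates the normal monomials (`linearIndependent_monomial`).

For `gl(1|2)` the order `z, k, k₁, k₂, e', f', p, e, f` places the central `z` first and the letters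
of `k` next. Hence the right ideal `k U(g)` is spanned by the PBW monomials with a factor from `k`,
which is family (iii) (`kU_le_span`). For `U(g) k` it suffices to multiply on the right by `e'` and
`f'`, since these generate `k`. Modulo `k U(g)` only the products `z^m p^n e^s f^t e'` and `z^m p^n
e^s f^t f'` matter. Moving the odd letter to the left and through `p^n` by the defining relation of
`α, β` produces exactly the families (i) and (ii); (ii) comes from `p^n f e'` and `p^n e f'`.
Conversely, (i) lies in the ideal because `e = [e, k]` and `f = [k, f]`, and (ii) because of the
same formula for `p^n e f'`.

Independence is triangularity: the monomials `z^m p^(n+1)`, `z^m p^n e`, `z^m p^n f` and those of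
(iii) are distinct, and the remaining terms of (ii) involve only `z^m p^i e f`, which can be killed.
-/

namespace LieSuperalgebra

open Module

/-! ### Words, inversions and normal words. -/

section words

variable {ι : Type*} [LinearOrder ι]

/-- The number of inversions of a word. -/
def inversions : List ι → ℕ
  | [] => 0
  | a :: l => l.countP (· < a) + inversions l

theorem inversions_swap_lt {i j : ι} (h : j < i) (u v : List ι) :
    inversions (u ++ j :: i :: v) < inversions (u ++ i :: j :: v) := by
  induction u with
  | nil =>
    simp only [List.nil_append, inversions, List.countP_cons, h, not_lt.2 h.le, decide_true,
      decide_false, if_true]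
    simp
    omega
  | cons a u ih =>
    have hp : (u ++ j :: i :: v).Perm (u ++ i :: j :: v) :=
      List.Perm.append_left u (List.Perm.swap i j v)
    simp only [List.cons_append, inversions, hp.countP_eq]
    omega

/-- The termination measure of straightening: length first, then the number of inversions. -/
def wordMeasure (w : List ι) : ℕ ×ₗ ℕ := toLex (w.length, inversions w)

theorem wordMeasure_swap {i j : ι} (h : j < i) (u v : List ι) :
    wordMeasure (u ++ j :: i :: v) < wordMeasure (u ++ i :: j :: v) := by
  rw [wordMeasure, wordMeasure, Prod.Lex.toLex_lt_toLex]
  right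
  exact ⟨by simp, inversions_swap_lt h u v⟩

theorem wordMeasure_of_length {w w' : List ι} (h : w.length < w'.length) :
    wordMeasure w < wordMeasure w' := by
  rw [wordMeasure, wordMeasure, Prod.Lex.toLex_lt_toLex]
  exact Or.inl h

/-- The letters `i, j` may follow each other in a normal word: `i < j`, or `i = j` is even. -/
def Ordered (π : ι → ZMod 2) (i j : ι) : Prop := i < j ∨ (i = j ∧ π i = 0)

theorem Ordered.trans {π : ι → ZMod 2} {i j k : ι} (h : Ordered π i j) (h' : Ordered π j k) :
    Ordered π i k := by
  rcases h with h | ⟨rfl, h⟩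
  · rcases h' with h' | ⟨rfl, -⟩
    · exact Or.inl (h.trans h')
    · exact Or.inl h
  · exact h'

/-- Normal words: weakly increasing, and without repeated odd letters. -/
def IsNormal (π : ι → ZMod 2) (w : List ι) : Prop := w.Pairwise (Ordered π)

theorem normal_iff {π : ι → ZMod 2} {w : List ι} :
    IsNormal π w ↔ ∀ i j u v, w = u ++ i :: j :: v → Ordered π i j := by
  have : Trans (Ordered π) (Ordered π) (Ordered π) := ⟨Ordered.trans⟩
  rw [IsNormal, ← List.isChain_iff_pairwise, List.isChain_iff_forall_rel_of_append_cons_cons]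

theorem zmod_two (d : ZMod 2) : d = 0 ∨ d = 1 := by revert d; decide

theorem not_ordered_iff {π : ι → ZMod 2} {i j : ι} :
    ¬ Ordered π i j ↔ j < i ∨ (i = j ∧ π i = 1) := by
  rcases lt_trichotomy i j with h | rfl | h
  · simp [Ordered, h, h.not_gt, h.ne]
  · rcases zmod_two (π i) with h | h <;> simp [Ordered, h]
  · simp [Ordered, h, h.not_gt, h.ne']

end words

theorem koszul_zero_left (d : ZMod 2) : koszul 0 d = 1 := by simp [koszul]

theorem koszul_zero_right (d : ZMod 2) : koszul d 0 = 1 := by simp [koszul]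

theorem koszul_one_one : koszul 1 1 = -1 := by simp [koszul, ZMod.val_one]

theorem koszul_comm (a b : ZMod 2) : koszul a b = koszul b a := by
  rw [koszul, koszul, mul_comm]

theorem koszul_mul_self (a b : ZMod 2) : koszul a b * koszul a b = 1 := by
  rcases zmod_two a with rfl | rfl <;> rcases zmod_two b with rfl | rfl <;>
    simp [koszul_zero_left, koszul_zero_right, koszul_one_one]

theorem koszul_add_left (a b c : ZMod 2) : koszul (a + b) c = koszul a c * koszul b c := by
  rcases zmod_two a with rfl | rfl <;> rcases zmod_two b with rfl | rfl <;>
    rcases zmod_two c with rfl | rfl <;>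
    simp [koszul_zero_left, koszul_zero_right, koszul_one_one, (by decide : (1 : ZMod 2) + 1 = 0)]

/-! ### Defects of the exchange relations and the identities between them. -/

section straightening

variable {g : Type*} [AddCommGroup g] [Module ℂ g] (L : LieSuperalgebra g)
variable {ι : Type*} (b : Basis ι ℂ g) {π : ι → ZMod 2}

/-- A homogeneous element is a combination of the basis vectors of its parity. -/
theorem mem_span_of_mem_part (hb : ∀ i, b i ∈ L.part (π i)) {a : ZMod 2} {x : g}
    (hx : x ∈ L.part a) : x ∈ Submodule.span ℂ {y | ∃ i, π i = a ∧ b i = y} := by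
  have key : ∀ x : g, ∃ y ∈ Submodule.span ℂ {y | ∃ i, π i = a ∧ b i = y},
      ∃ y' ∈ L.part (a + 1), x = y + y' := by
    intro x
    induction b.mem_span x using Submodule.span_induction with
    | mem x h =>
      obtain ⟨i, rfl⟩ := h
      by_cases h : π i = a
      · exact ⟨b i, Submodule.subset_span ⟨i, h, rfl⟩, 0, zero_mem _, by simp⟩
      · refine ⟨0, zero_mem _, b i, ?_, by simp⟩
        have : π i = a + 1 := by
          revert h; clear hx; generalize π i = c; revert c a; decide
        exact this ▸ hb i
    | zero => exact ⟨0, zero_mem _, 0, zero_mem _, by simp⟩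
    | add x y _ _ hx hy =>
      obtain ⟨p, hp, p', hp', rfl⟩ := hx
      obtain ⟨q, hq, q', hq', rfl⟩ := hy
      exact ⟨p + q, add_mem hp hq, p' + q', add_mem hp' hq', by abel⟩
    | smul c x _ hx =>
      obtain ⟨p, hp, p', hp', rfl⟩ := hx
      exact ⟨c • p, Submodule.smul_mem _ _ hp, c • p', Submodule.smul_mem _ _ hp', smul_add _ _ _⟩
  obtain ⟨y, hy, y', hy', rfl⟩ := key x
  have hya : y ∈ L.part a := by
    refine Submodule.span_le.2 ?_ hy
    rintro _ ⟨i, rfl, rfl⟩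
    exact hb i
  have h1 : y' ∈ L.part a := by simpa using sub_mem hx hya
  have h0 : y' = 0 := by
    have hd := L.isCompl.disjoint
    rw [Submodule.disjoint_def] at hd
    rcases zmod_two a with rfl | rfl
    · exact hd _ h1 (by simpa using hy')
    · exact hd _ (by simpa [(by decide : (1 : ZMod 2) + 1 = 0)] using hy') h1
  simpa [h0] using hy

variable {S : Type*} [AddCommGroup S] [Module ℂ S]

/-- The failure of a function on words to respect the defining relation of `U(g)` that exchanges
the letters `i, j` at a given position. -/
noncomputable def defect (π : ι → ZMod 2) (φ : List ι → S) (u : List ι) (i j : ι) (v : List ι) : S :=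
  φ (u ++ i :: j :: v) - koszul (π i) (π j) • φ (u ++ j :: i :: v)
    - b.constr ℂ (fun k => φ (u ++ k :: v)) (L.bracket (b i) (b j))

variable {L b}

/-- By super skew-symmetry the two defects differ by the factor `-koszul (π i) (π j)`, so only
out-of-order pairs need to be examined. -/
theorem defect_flip (hb : ∀ i, b i ∈ L.part (π i)) {φ : List ι → S} {u : List ι} {i j : ι}
    {v : List ι} (h : defect L b π φ u i j v = 0) : defect L b π φ u j i v = 0 := by
  rw [defect] at h ⊢
  rw [L.skew (hb j) (hb i), koszul_comm (π j)]
  have hk := koszul_mul_self (π i) (π j)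
  rcases zmod_two (π i) with hi | hi <;> rcases zmod_two (π j) with hj | hj <;>
    simp only [hi, hj, koszul_zero_left, koszul_zero_right, koszul_one_one, map_neg, map_smul]
      at h ⊢
  · linear_combination (norm := module) (-1 : ℂ) • h
  · linear_combination (norm := module) (-1 : ℂ) • h
  · linear_combination (norm := module) (-1 : ℂ) • h
  · linear_combination (norm := module) h

theorem defect_self (hb : ∀ i, b i ∈ L.part (π i)) {i : ι} (hi : π i = 0) (φ : List ι → S)
    (u v : List ι) : defect L b π φ u i i v = 0 := by
  have h := L.skew (hb i) (hb i)
  rw [hi, koszul_zero_left, one_smul] at h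
  have h0 : L.bracket (b i) (b i) = 0 := by
    have h2 : (2 : ℂ) • L.bracket (b i) (b i) = 0 := by linear_combination (norm := module) h
    simpa using h2
  simp [defect, h0, hi, koszul_zero_left]

variable (L b)

/-- Exchanges of letters at disjoint positions commute. -/
theorem defect_disjoint (φ : List ι → S) (u : List ι) (i j : ι) (m : List ι) (k l : ι)
    (v : List ι) :
    defect L b π φ u i j (m ++ k :: l :: v)
        - koszul (π k) (π l) • defect L b π φ u i j (m ++ l :: k :: v)
        - b.constr ℂ (fun c => defect L b π φ u i j (m ++ c :: v)) (L.bracket (b k) (b l))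
      = defect L b π φ (u ++ i :: j :: m) k l v
        - koszul (π i) (π j) • defect L b π φ (u ++ j :: i :: m) k l v
        - b.constr ℂ (fun c => defect L b π φ (u ++ c :: m) k l v) (L.bracket (b i) (b j)) := by
  set x := L.bracket (b i) (b j) with hx
  set y := L.bracket (b k) (b l) with hy
  have e1 : b.constr ℂ (fun c => defect L b π φ u i j (m ++ c :: v)) y
      = b.constr ℂ (fun c => φ (u ++ i :: j :: (m ++ c :: v))) y
        - koszul (π i) (π j) • b.constr ℂ (fun c => φ (u ++ j :: i :: (m ++ c :: v))) y
        - b.constr ℂ (fun c => b.constr ℂ (fun d => φ (u ++ d :: (m ++ c :: v))) x) y := by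
    rw [← LinearMap.smul_apply, ← LinearMap.sub_apply, ← LinearMap.sub_apply]
    congr 1
    refine b.ext fun c => ?_
    simp [defect, hx]
  have e2 : b.constr ℂ (fun c => defect L b π φ (u ++ c :: m) k l v) x
      = b.constr ℂ (fun c => φ (u ++ c :: m ++ k :: l :: v)) x
        - koszul (π k) (π l) • b.constr ℂ (fun c => φ (u ++ c :: m ++ l :: k :: v)) x
        - b.constr ℂ (fun c => b.constr ℂ (fun d => φ (u ++ c :: m ++ d :: v)) y) x := by
    rw [← LinearMap.smul_apply, ← LinearMap.sub_apply, ← LinearMap.sub_apply]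
    congr 1
    refine b.ext fun c => ?_
    simp [defect, hy]
  have e3 : b.constr ℂ (fun c => b.constr ℂ (fun d => φ (u ++ d :: (m ++ c :: v))) x) y
      = b.constr ℂ (fun c => b.constr ℂ (fun d => φ (u ++ c :: m ++ d :: v)) y) x := by
    clear_value x
    clear e1 e2 hx
    induction b.mem_span x using Submodule.span_induction with
    | mem x h =>
      obtain ⟨d, rfl⟩ := h
      simp [Basis.constr_basis]
    | zero =>
      have : (fun _ : ι => (0 : S)) = 0 := rfl
      simp [this]
    | add x x' _ _ h h' =>
      rw [map_add, ← h, ← h', ← LinearMap.add_apply]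
      congr 1
      exact b.ext fun c => by simp
    | smul r x _ h =>
      rw [map_smul, ← h, ← LinearMap.smul_apply]
      congr 1
      exact b.ext fun c => by simp
  rw [e1, e2, e3]
  simp only [defect, ← hx, ← hy, List.append_assoc, List.cons_append]
  module

variable {L b}

/-- The six exchanges that reverse three consecutive letters are related by the Jacobi
identity. -/
theorem defect_overlap (hb : ∀ i, b i ∈ L.part (π i)) (φ : List ι → S) (u : List ι) (i j k : ι)
    (v : List ι) (hφ : ∀ c d, defect L b π φ u c d v = 0) :
    defect L b π φ u i j (k :: v) + koszul (π i) (π j) • defect L b π φ (u ++ [j]) i k v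
        + (koszul (π i) (π j) * koszul (π i) (π k)) • defect L b π φ u j k (i :: v)
      = defect L b π φ (u ++ [i]) j k v + koszul (π j) (π k) • defect L b π φ u i k (j :: v)
        + (koszul (π j) (π k) * koszul (π i) (π k)) • defect L b π φ (u ++ [k]) i j v := by
  -- `M₁` and `M₂` extend `φ` linearly in one, respectively two, letters between `u` and `v`. The
  -- hypothesis `hφ` says that `M₂` obeys the relation of `U(g)` on basis vectors, hence on all
  -- homogeneous elements; this allows a bracket to be exchanged with a letter.
  let M₁ : g →ₗ[ℂ] S := b.constr ℂ fun c => φ (u ++ c :: v)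
  let M₂ : g →ₗ[ℂ] g →ₗ[ℂ] S := b.constr ℂ fun c => b.constr ℂ fun d => φ (u ++ c :: d :: v)
  have hM : ∀ {a a' : ZMod 2} {x y : g}, x ∈ L.part a → y ∈ L.part a' →
      M₂ x y = koszul a a' • M₂ y x + M₁ (L.bracket x y) := by
    intro a a' x y hx hy
    have hx' := L.mem_span_of_mem_part b hb hx
    have hy' := L.mem_span_of_mem_part b hb hy
    clear hx hy
    induction hx' using Submodule.span_induction with
    | mem x h =>
      obtain ⟨c, rfl, rfl⟩ := h
      induction hy' using Submodule.span_induction with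
      | mem y h =>
        obtain ⟨d, rfl, rfl⟩ := h
        have := hφ c d
        rw [defect] at this
        simp only [M₂, M₁, Basis.constr_basis]
        linear_combination (norm := module) this
      | zero => simp
      | add y y' _ _ h h' => simp only [map_add, LinearMap.add_apply, smul_add, h, h']; abel
      | smul r y _ h =>
        simp only [map_smul, LinearMap.smul_apply, h]
        module
    | zero => simp
    | add x x' _ _ h h' => simp only [map_add, LinearMap.add_apply, smul_add, h, h']; abel
    | smul r x _ h =>
      simp only [map_smul, LinearMap.smul_apply, h]
      module
  have hl : ∀ (x : g) (c : ι), b.constr ℂ (fun d => φ (u ++ d :: c :: v)) x = M₂ x (b c) := by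
    intro x c
    rw [← LinearMap.flip_apply]
    congr 1
    exact b.ext fun d => by simp [M₂, Basis.constr_basis]
  have hr : ∀ (x : g) (c : ι), b.constr ℂ (fun d => φ (u ++ c :: d :: v)) x = M₂ (b c) x := by
    intro x c
    simp [M₂, Basis.constr_basis]
  -- The values of `φ` with all three letters present cancel in the claim. The remaining terms pair
  -- a bracket with the third letter; exchanging the two factors leaves nested brackets, whose sum
  -- vanishes by Jacobi.
  have h1 := hM (L.bracket_mem (hb i) (hb j)) (hb k)
  have h2 := hM (hb i) (L.bracket_mem (hb j) (hb k))
  have h3 := hM (L.bracket_mem (hb i) (hb k)) (hb j)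
  have h4 := L.skew (L.bracket_mem (hb i) (hb k)) (hb j)
  have h5 := congrArg M₁ (L.jacobi (hb i) (hb j) (hb k))
  rw [h4] at h3
  simp only [defect, List.append_assoc, List.cons_append, List.nil_append, hl, hr]
  rw [koszul_comm (π i) (π j + π k)] at h2
  simp only [koszul_add_left, koszul_comm (π k) (π j), koszul_comm (π j) (π i),
    koszul_comm (π k) (π i), map_neg, map_smul, map_add] at h1 h2 h3 h5
  rcases zmod_two (π i) with hi | hi <;> rcases zmod_two (π j) with hj | hj <;>
    rcases zmod_two (π k) with hk | hk <;>
    simp only [hi, hj, hk, koszul_zero_left, koszul_zero_right, koszul_one_one] at h1 h2 h3 h5 ⊢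
  · linear_combination (norm := module) (-1 : ℂ) • h1 + h2 + (1 : ℂ) • h3 + h5
  · linear_combination (norm := module) (-1 : ℂ) • h1 + h2 + (1 : ℂ) • h3 + h5
  · linear_combination (norm := module) (-1 : ℂ) • h1 + h2 + (1 : ℂ) • h3 + h5
  · linear_combination (norm := module) (-1 : ℂ) • h1 + h2 + (-1 : ℂ) • h3 + h5
  · linear_combination (norm := module) (-1 : ℂ) • h1 + h2 + (1 : ℂ) • h3 + h5
  · linear_combination (norm := module) (-1 : ℂ) • h1 + h2 + (1 : ℂ) • h3 + h5
  · linear_combination (norm := module) (-1 : ℂ) • h1 + h2 + (1 : ℂ) • h3 + h5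
  · linear_combination (norm := module) (-1 : ℂ) • h1 + h2 + (-1 : ℂ) • h3 + h5

end straightening

end LieSuperalgebra

namespace LieSuperalgebra

open Module

theorem constr_eq_zero {g : Type*} [AddCommGroup g] [Module ℂ g] {ι : Type*} {b : Basis ι ℂ g}
    {S : Type*} [AddCommGroup S] [Module ℂ S] {f : ι → S} (hf : ∀ i, f i = 0) (x : g) : b.constr ℂ f x = 0 := by
  rw [show f = 0 from funext hf, map_zero, LinearMap.zero_apply]

/-! ### The straightening procedure and its confluence. -/

section straightening

variable {g : Type*} [AddCommGroup g] [Module ℂ g] (L : LieSuperalgebra g)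
variable {ι : Type*} [LinearOrder ι] (b : Basis ι ℂ g) (π : ι → ZMod 2)

open Classical in
/-- Straightening of words: rewrite some pair of adjacent letters that is out of order, until only
normal words are left. -/
noncomputable def straighten (w : List ι) : List ι →₀ ℂ :=
  if h : ∃ t : (List ι × ι) × (ι × List ι),
      w = t.1.1 ++ t.1.2 :: t.2.1 :: t.2.2 ∧ ¬ Ordered π t.1.2 t.2.1 then
    -- An equal pair that is out of order is odd, and then `x x = -x x + [x, x]`, so `x x` is half
    -- the bracket.
    if _ : h.choose.1.2 = h.choose.2.1 then
      (1 / 2 : ℂ) • b.constr ℂ (fun k => straighten (h.choose.1.1 ++ k :: h.choose.2.2))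
        (L.bracket (b h.choose.1.2) (b h.choose.2.1))
    else
      koszul (π h.choose.1.2) (π h.choose.2.1) •
          straighten (h.choose.1.1 ++ h.choose.2.1 :: h.choose.1.2 :: h.choose.2.2)
        + b.constr ℂ (fun k => straighten (h.choose.1.1 ++ k :: h.choose.2.2))
          (L.bracket (b h.choose.1.2) (b h.choose.2.1))
  else Finsupp.single w 1
termination_by wordMeasure w
decreasing_by
  · apply wordMeasure_of_length
    have := congrArg List.length h.choose_spec.1
    simp at this ⊢
    omega
  · rw [congrArg wordMeasure h.choose_spec.1]
    apply wordMeasure_swap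
    rcases not_ordered_iff.1 h.choose_spec.2 with h | h
    · exact h
    · exact absurd h.1 ‹_›
  · apply wordMeasure_of_length
    have := congrArg List.length h.choose_spec.1
    simp at this ⊢
    omega

variable {π}

theorem straighten_of_normal {w : List ι} (hw : IsNormal π w) :
    straighten L b π w = Finsupp.single w 1 := by
  rw [straighten, dif_neg]
  rintro ⟨t, ht, ht'⟩
  exact ht' (normal_iff.1 hw _ _ _ _ ht)

/-- At the position picked by the recursion the defect vanishes by construction. Confluence has to
extend this to all other out-of-order positions of the same word. -/
theorem exists_defect_straighten {w : List ι} (hw : ¬ IsNormal π w) :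
    ∃ u i j v, w = u ++ i :: j :: v ∧ ¬ Ordered π i j ∧
      defect L b π (straighten L b π) u i j v = 0 := by
  have h : ∃ t : (List ι × ι) × (ι × List ι),
      w = t.1.1 ++ t.1.2 :: t.2.1 :: t.2.2 ∧ ¬ Ordered π t.1.2 t.2.1 := by
    rw [normal_iff] at hw
    push Not at hw
    obtain ⟨i, j, u, v, h, h'⟩ := hw
    exact ⟨((u, i), (j, v)), h, h'⟩
  refine ⟨h.choose.1.1, h.choose.1.2, h.choose.2.1, h.choose.2.2, h.choose_spec.1,
    h.choose_spec.2, ?_⟩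
  have hF := straighten.eq_1 L b π w
  rw [dif_pos h] at hF
  have hspec := h.choose_spec
  generalize h.choose = t at hF hspec ⊢
  obtain ⟨⟨u, i⟩, ⟨j, v⟩⟩ := t
  simp only at hF hspec ⊢
  rw [defect, ← hspec.1]
  split_ifs at hF with hij
  · subst hij
    have hi : π i = 1 := by
      rcases not_ordered_iff.1 hspec.2 with h | h
      · exact absurd h (lt_irrefl _)
      · exact h.2
    rw [← hspec.1, hi, koszul_one_one]
    linear_combination (norm := module) (2 : ℂ) • hF
  · linear_combination (norm := module) hF

variable {L b}

section confluence

variable {S : Type*} [AddCommGroup S] [Module ℂ S]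

/-- All defects vanish at positions that are out of order, for words below `w`. -/
def NoDefectBelow (L : LieSuperalgebra g) (b : Basis ι ℂ g) (π : ι → ZMod 2) (φ : List ι → S)
    (w : List ι) : Prop :=
  ∀ u i j v, wordMeasure (u ++ i :: j :: v) < wordMeasure w → ¬ Ordered π i j →
    defect L b π φ u i j v = 0

/-- For strictly shorter words the order of the pair no longer matters: flipping it preserves the
length, and equal even letters have no defect. -/
theorem NoDefectBelow.of_length (hb : ∀ i, b i ∈ L.part (π i)) {φ : List ι → S} {w : List ι}
    (h : NoDefectBelow L b π φ w) {u : List ι} {i j : ι} {v : List ι}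
    (hl : (u ++ i :: j :: v).length < w.length) : defect L b π φ u i j v = 0 := by
  rcases lt_trichotomy i j with hij | rfl | hij
  · refine defect_flip hb (h u j i v (wordMeasure_of_length ?_) (not_ordered_iff.2 (Or.inl hij)))
    simpa using hl
  · rcases zmod_two (π i) with hi | hi
    · exact defect_self hb hi φ u v
    · exact h u i i v (wordMeasure_of_length hl) (not_ordered_iff.2 (Or.inr ⟨rfl, hi⟩))
  · exact h u i j v (wordMeasure_of_length hl) (not_ordered_iff.2 (Or.inl hij))

/-- In `defect_disjoint` the bracket terms concern shorter words, and the swapped terms concern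
words with fewer inversions, so all of them vanish. The exception is a pair of equal odd letters,
where the swap changes nothing and the sign `-1` doubles the defect instead; hence the factors 2. -/
theorem defect_disjoint_iff (hb : ∀ i, b i ∈ L.part (π i)) {φ : List ι → S} {u : List ι}
    {i j : ι} {m : List ι} {k l : ι} {v : List ι}
    (h : NoDefectBelow L b π φ (u ++ i :: j :: (m ++ k :: l :: v)))
    (hij : ¬ Ordered π i j) (hkl : ¬ Ordered π k l) :
    defect L b π φ u i j (m ++ k :: l :: v) = 0 ↔
      defect L b π φ (u ++ i :: j :: m) k l v = 0 := by
  have hd := defect_disjoint L b (π := π) φ u i j m k l v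
  rw [constr_eq_zero (fun c => h.of_length hb (by simp)),
    constr_eq_zero (fun c => h.of_length hb (by simp))] at hd
  have h1 : k ≠ l → defect L b π φ u i j (m ++ l :: k :: v) = 0 := by
    intro hne
    have hlt : l < k := (not_ordered_iff.1 hkl).resolve_right fun h => hne h.1
    refine h _ _ _ _ ?_ hij
    simpa using wordMeasure_swap hlt (u ++ i :: j :: m) v
  have h2 : i ≠ j → defect L b π φ (u ++ j :: i :: m) k l v = 0 := by
    intro hne
    have hlt : j < i := (not_ordered_iff.1 hij).resolve_right fun h => hne h.1
    refine h _ _ _ _ ?_ hkl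
    simpa using wordMeasure_swap hlt u (m ++ k :: l :: v)
  have odd : ∀ {i}, ¬ Ordered π i i → π i = 1 := fun h =>
    ((not_ordered_iff.1 h).resolve_left (lt_irrefl _)).2
  by_cases hkl' : k = l <;> by_cases hij' : i = j
  · subst hkl' hij'
    rw [odd hij, odd hkl, koszul_one_one] at hd
    have : defect L b π φ u i i (m ++ k :: k :: v) = defect L b π φ (u ++ i :: i :: m) k k v := by
      linear_combination (norm := module) (1 / 2 : ℂ) • hd
    rw [this]
  · subst hkl'
    rw [odd hkl, koszul_one_one, h2 hij'] at hd
    have : defect L b π φ (u ++ i :: j :: m) k k v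
        = (2 : ℂ) • defect L b π φ u i j (m ++ k :: k :: v) := by
      linear_combination (norm := module) -hd
    rw [this, smul_eq_zero_iff_right two_ne_zero]
  · subst hij'
    rw [odd hij, koszul_one_one, h1 hkl'] at hd
    have : defect L b π φ u i i (m ++ k :: l :: v)
        = (2 : ℂ) • defect L b π φ (u ++ i :: i :: m) k l v := by
      linear_combination (norm := module) hd
    rw [this, smul_eq_zero_iff_right two_ne_zero]
  · rw [h1 hkl', h2 hij'] at hd
    simp only [smul_zero, sub_zero] at hd
    rw [hd]

/-- For distinct letters four of the six terms of `defect_overlap` belong to smaller words, which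
leaves the two compared here. Coinciding odd letters make terms merge, with multiplicity 2 for one
coincidence and 3 when all letters agree. -/
theorem defect_overlap_iff (hb : ∀ i, b i ∈ L.part (π i)) {φ : List ι → S} {u : List ι}
    {i j k : ι} {v : List ι} (h : NoDefectBelow L b π φ (u ++ i :: j :: k :: v))
    (hij : ¬ Ordered π i j) (hjk : ¬ Ordered π j k) :
    defect L b π φ u i j (k :: v) = 0 ↔ defect L b π φ (u ++ [i]) j k v = 0 := by
  have hd := defect_overlap hb φ u i j k v fun c d => h.of_length hb (by simp)
  have odd : ∀ {i}, ¬ Ordered π i i → π i = 1 := fun h =>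
    ((not_ordered_iff.1 h).resolve_left (lt_irrefl _)).2
  have s12 : ∀ {x y z}, y < x → wordMeasure (u ++ y :: x :: z :: v)
      < wordMeasure (u ++ x :: y :: z :: v) := fun h => wordMeasure_swap h u _
  have s23 : ∀ {x y z}, z < y → wordMeasure (u ++ x :: z :: y :: v)
      < wordMeasure (u ++ x :: y :: z :: v) := by
    intro x y z h
    simpa using wordMeasure_swap h (u ++ [x]) v
  by_cases hij' : i = j
  · subst hij'
    by_cases hjk' : i = k
    · subst hjk'
      rw [odd hij, koszul_one_one] at hd
      have : defect L b π φ u i i (i :: v) = defect L b π φ (u ++ [i]) i i v := by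
        linear_combination (norm := module) (1 / 3 : ℂ) • hd
      rw [this]
    · have hlt : k < i := (not_ordered_iff.1 hjk).resolve_right fun h => hjk' h.1
      rw [odd hij, koszul_one_one, h u i k (i :: v) (s23 hlt) hjk,
        h (u ++ [k]) i i v (by simpa using (s12 hlt).trans (s23 hlt)) hij] at hd
      have : defect L b π φ u i i (k :: v) = (2 : ℂ) • defect L b π φ (u ++ [i]) i k v := by
        linear_combination (norm := module) hd
      rw [this, smul_eq_zero_iff_right two_ne_zero]
  · have hlt : j < i := (not_ordered_iff.1 hij).resolve_right fun h => hij' h.1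
    by_cases hjk' : j = k
    · subst hjk'
      rw [odd hjk, koszul_one_one,
        h (u ++ [j]) i j v (by simpa using s12 hlt) hij,
        h u j j (i :: v) ((s23 hlt).trans (s12 hlt)) hjk] at hd
      have : defect L b π φ (u ++ [i]) j j v = (2 : ℂ) • defect L b π φ u i j (j :: v) := by
        linear_combination (norm := module) -hd
      rw [this, smul_eq_zero_iff_right two_ne_zero]
    · have hlt' : k < j := (not_ordered_iff.1 hjk).resolve_right fun h => hjk' h.1
      have hik : ¬ Ordered π i k := not_ordered_iff.2 (Or.inl (hlt'.trans hlt))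
      rw [h (u ++ [j]) i k v (by simpa using s12 hlt) hik,
        h u j k (i :: v) ((s23 (hlt'.trans hlt)).trans (s12 hlt)) hjk,
        h u i k (j :: v) (s23 hlt') hik,
        h (u ++ [k]) i j v (by simpa using (s12 (hlt'.trans hlt)).trans (s23 hlt')) hij] at hd
      simp only [smul_zero, add_zero] at hd
      rw [hd]

/-- Two positions in one word coincide, overlap in one letter, or are disjoint; the cases are read
off from the difference `a` of the two prefixes. -/
theorem defect_eq_zero_of_eq (hb : ∀ i, b i ∈ L.part (π i)) {φ : List ι → S} {u : List ι}
    {i j : ι} {v : List ι} {u' : List ι} {i' j' : ι} {v' : List ι}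
    (h : NoDefectBelow L b π φ (u ++ i :: j :: v)) (hij : ¬ Ordered π i j)
    (hij' : ¬ Ordered π i' j') (he : u ++ i :: j :: v = u' ++ i' :: j' :: v')
    (h0 : defect L b π φ u i j v = 0) : defect L b π φ u' i' j' v' = 0 := by
  have he' := he
  rw [List.append_eq_append_iff] at he'
  obtain ⟨a, rfl, ha⟩ | ⟨a, rfl, ha⟩ := he'
  · match a, ha with
    | [], ha =>
      obtain ⟨rfl, rfl, rfl⟩ := by simpa using ha
      simpa using h0
    | [x], ha =>
      obtain ⟨rfl, rfl, rfl⟩ := by simpa using ha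
      exact (defect_overlap_iff hb h hij hij').1 h0
    | x :: y :: m, ha =>
      obtain ⟨rfl, rfl, rfl⟩ := by simpa using ha
      exact (defect_disjoint_iff hb h hij hij').1 h0
  · rw [he] at h
    match a, ha with
    | [], ha =>
      obtain ⟨rfl, rfl, rfl⟩ := by simpa using ha
      simpa using h0
    | [x], ha =>
      obtain ⟨rfl, rfl, rfl⟩ := by simpa using ha
      exact (defect_overlap_iff hb h hij' hij).2 h0
    | x :: y :: m, ha =>
      obtain ⟨rfl, rfl, rfl⟩ := by simpa using ha
      exact (defect_disjoint_iff hb h hij' hij).2 h0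

end confluence

/-- Straightening respects the relations of `U(g)`. -/
theorem defect_straighten (hb : ∀ i, b i ∈ L.part (π i)) (u : List ι) (i j : ι) (v : List ι) :
    defect L b π (straighten L b π) u i j v = 0 := by
  have key : ∀ w, NoDefectBelow L b π (straighten L b π) w := by
    intro w
    induction hn : wordMeasure w using WellFoundedLT.induction generalizing w with
    | ind n ih =>
      subst hn
      intro u i j v hlt hij
      have hnn : ¬ IsNormal π (u ++ i :: j :: v) := fun h => hij (normal_iff.1 h _ _ _ _ rfl)
      obtain ⟨u', i', j', v', he, hij', h0⟩ := exists_defect_straighten L b hnn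
      refine defect_eq_zero_of_eq hb ?_ hij' hij he.symm h0
      rw [← he]
      exact ih _ hlt _ rfl
  -- The additional first letter only serves to make the given word strictly shorter than the
  -- bounding word.
  exact (key (i :: u ++ i :: j :: v)).of_length hb (by simp)

end straightening

/-! ### The Poincaré–Birkhoff–Witt theorem. -/

section pbw

variable {g : Type*} [AddCommGroup g] [Module ℂ g] (L : LieSuperalgebra g)
variable {ι : Type*} (b : Basis ι ℂ g)

/-- The monomial of a word in `U(g)`. -/
noncomputable def monomial (w : List ι) : L.U := (w.map fun i => L.ι (b i)).prod

@[simp]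
theorem monomial_nil : L.monomial b [] = 1 := rfl

@[simp]
theorem monomial_cons (i : ι) (w : List ι) :
    L.monomial b (i :: w) = L.ι (b i) * L.monomial b w := by simp [monomial]

@[simp]
theorem monomial_append (w w' : List ι) :
    L.monomial b (w ++ w') = L.monomial b w * L.monomial b w' := by simp [monomial]

theorem monomial_replicate (n : ℕ) (i : ι) :
    L.monomial b (List.replicate n i) = L.ι (b i) ^ n := by simp [monomial]

variable {L} in
theorem ι_mul_ι {a c : ZMod 2} {x y : g} (hx : x ∈ L.part a) (hy : y ∈ L.part c) :
    L.ι x * L.ι y = koszul a c • (L.ι y * L.ι x) + L.ι (L.bracket x y) := by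
  have := RingQuot.mkAlgHom_rel ℂ (Rel.mk (L := L) hx hy)
  rw [map_add, map_smul, map_mul, map_mul] at this
  exact this

theorem tensorAlgebra_basis_apply (w : FreeMonoid ι) :
    b.tensorAlgebra w = (w.toList.map fun i => TensorAlgebra.ι ℂ (b i)).prod := by
  have h : FreeAlgebra.basisFreeMonoid ℂ ι w = FreeMonoid.lift (FreeAlgebra.ι ℂ) w := by
    simp only [FreeAlgebra.basisFreeMonoid, Basis.map_apply, Finsupp.coe_basisSingleOne]
    exact (MonoidAlgebra.lift_single _ _ _).trans (one_smul _ _)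
  rw [Basis.tensorAlgebra, Basis.map_apply, h, FreeMonoid.lift_apply]
  simp only [AlgEquiv.toLinearEquiv_apply, map_list_prod, List.map_map]
  congr 2
  funext i
  simp

/-- The monomial of a word in the tensor algebra. -/
noncomputable def tensorMonomial (w : List ι) : TensorAlgebra ℂ g :=
  (w.map fun i => TensorAlgebra.ι ℂ (b i)).prod

theorem mem_span_tensorMonomial (x : TensorAlgebra ℂ g) :
    x ∈ Submodule.span ℂ (Set.range (tensorMonomial b)) := by
  refine Submodule.span_mono ?_ (b.tensorAlgebra.mem_span x)
  rintro _ ⟨w, rfl⟩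
  exact ⟨w.toList, (tensorAlgebra_basis_apply b w).symm⟩

variable {L b} in
theorem bracket_middle (u v : List ι) (x : g) :
    L.monomial b u * L.ι x * L.monomial b v
      = (b.repr x).sum fun k r => r • L.monomial b (u ++ k :: v) := by
  conv_lhs => rw [← b.linearCombination_repr x]
  rw [Finsupp.linearCombination_apply, Finsupp.sum, Finsupp.sum, map_sum, Finset.mul_sum,
    Finset.sum_mul]
  simp [mul_assoc]

variable [LinearOrder ι] {π : ι → ZMod 2}

/-- Straightening, as a linear map on the tensor algebra. -/
noncomputable def straightenLin (π : ι → ZMod 2) : TensorAlgebra ℂ g →ₗ[ℂ] List ι →₀ ℂ :=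
  b.tensorAlgebra.constr ℂ fun w => straighten L b π w.toList

theorem straightenLin_tensorMonomial (w : List ι) :
    straightenLin L b π (tensorMonomial b w) = straighten L b π w := by
  have := tensorAlgebra_basis_apply b (FreeMonoid.ofList w)
  rw [FreeMonoid.toList_ofList] at this
  rw [tensorMonomial, ← this, straightenLin, Basis.constr_basis, FreeMonoid.toList_ofList]

theorem straightenLin_middle (u v : List ι) (x : g) :
    straightenLin L b π (tensorMonomial b u * TensorAlgebra.ι ℂ x * tensorMonomial b v)
      = b.constr ℂ (fun k => straighten L b π (u ++ k :: v)) x := by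
  have : straightenLin L b π ∘ₗ LinearMap.mulRight ℂ (tensorMonomial b v) ∘ₗ
      LinearMap.mulLeft ℂ (tensorMonomial b u) ∘ₗ TensorAlgebra.ι ℂ
        = b.constr ℂ (fun k => straighten L b π (u ++ k :: v)) := by
    refine b.ext fun k => ?_
    rw [Basis.constr_basis, ← straightenLin_tensorMonomial]
    simp [tensorMonomial, mul_assoc]
  exact LinearMap.congr_fun this x

variable {L b}

/-- By multilinearity the context may be taken to consist of words and the relation to involve basis
vectors; the claim is then `defect_straighten`. -/
theorem straightenLin_rel (hb : ∀ i, b i ∈ L.part (π i)) {x y : TensorAlgebra ℂ g}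
    (h : L.Rel x y) (s t : TensorAlgebra ℂ g) :
    straightenLin L b π (s * x * t) = straightenLin L b π (s * y * t) := by
  obtain ⟨hx, hy⟩ := h
  rename_i a c x y
  induction mem_span_tensorMonomial b s using Submodule.span_induction with
  | zero => simp
  | add s s' _ _ h h' => simp only [add_mul, map_add, h, h']
  | smul r s _ h => simp only [smul_mul_assoc, map_smul, h]
  | mem s hs =>
  obtain ⟨u, rfl⟩ := hs
  induction mem_span_tensorMonomial b t using Submodule.span_induction with
  | zero => simp
  | add s s' _ _ h h' => simp only [mul_add, map_add, h, h']
  | smul r s _ h => simp only [mul_smul_comm, map_smul, h]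
  | mem t ht =>
  obtain ⟨v, rfl⟩ := ht
  have hx' := L.mem_span_of_mem_part b hb hx
  have hy' := L.mem_span_of_mem_part b hb hy
  clear hx hy
  induction hx' using Submodule.span_induction with
  | zero => simp
  | add s s' _ _ h h' =>
    simp only [mul_add, add_mul, map_add, smul_add, h, h', LinearMap.add_apply]
    abel
  | smul r s _ h =>
    simp only [mul_smul_comm, smul_mul_assoc, map_smul, h, smul_add, add_mul, mul_add,
      smul_comm r, LinearMap.smul_apply, map_add]
  | mem x h =>
  obtain ⟨i, rfl, rfl⟩ := h
  induction hy' using Submodule.span_induction with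
  | zero => simp
  | add s s' _ _ h h' =>
    simp only [mul_add, add_mul, map_add, smul_add, h, h']
    abel
  | smul r s _ h =>
    simp only [mul_smul_comm, smul_mul_assoc, map_smul, h, smul_add, add_mul, mul_add,
      smul_comm r, map_add]
  | mem y h =>
  obtain ⟨j, rfl, rfl⟩ := h
  have hd := defect_straighten hb u i j v
  have hm : ∀ i j : ι, tensorMonomial b u * (TensorAlgebra.ι ℂ (b i) * TensorAlgebra.ι ℂ (b j)) *
      tensorMonomial b v = tensorMonomial b (u ++ i :: j :: v) := by
    intro i j
    simp [tensorMonomial, mul_assoc]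
  rw [mul_add, add_mul, map_add, straightenLin_middle, mul_smul_comm, smul_mul_assoc, map_smul,
    hm, hm, straightenLin_tensorMonomial, straightenLin_tensorMonomial]
  rw [defect] at hd
  linear_combination (norm := module) hd

theorem straightenLin_eq (hb : ∀ i, b i ∈ L.part (π i)) {x y : TensorAlgebra ℂ g}
    (h : RingQuot.mkAlgHom ℂ L.Rel x = RingQuot.mkAlgHom ℂ L.Rel y) :
    straightenLin L b π x = straightenLin L b π y := by
  -- Requiring equal straightening in every two-sided context makes this a ring congruence. It
  -- contains the defining relations, hence the kernel of the quotient map.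
  let C : RingCon (TensorAlgebra ℂ g) :=
    { r := fun x y => ∀ s t, straightenLin L b π (s * x * t) = straightenLin L b π (s * y * t)
      iseqv := ⟨fun _ _ _ => rfl, fun h s t => (h s t).symm,
        fun h h' s t => (h s t).trans (h' s t)⟩
      add' := by
        intro x y x' y' h h' s t
        rw [mul_add, mul_add, add_mul, add_mul, map_add, map_add, h, h']
      mul' := by
        intro x y x' y' h h' s t
        have h1 := h s (x' * t)
        have h2 := h' (s * y) t
        simp only [mul_assoc] at h1 h2 ⊢
        rw [h1, h2] }
  have hC : ∀ ⦃x y⦄, L.Rel x y → C.mk' x = C.mk' y := fun x y h =>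
    (RingCon.eq C).2 (straightenLin_rel hb h)
  have h' : RingQuot.mkRingHom L.Rel x = RingQuot.mkRingHom L.Rel y := by
    rw [← RingQuot.mkAlgHom_coe ℂ]
    exact h
  have h2 := congrArg (RingQuot.lift ⟨C.mk', hC⟩) h'
  rw [RingQuot.lift_mkRingHom_apply, RingQuot.lift_mkRingHom_apply] at h2
  simpa using (RingCon.eq C).1 h2 1 1

/-- Poincaré–Birkhoff–Witt: the normal monomials are linearly independent. -/
theorem linearIndependent_monomial (hb : ∀ i, b i ∈ L.part (π i)) :
    LinearIndependent ℂ fun w : {w : List ι // IsNormal π w} => L.monomial b w := by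
  rw [linearIndependent_iff]
  intro l hl
  have hm : ∀ w : List ι, L.monomial b w = RingQuot.mkAlgHom ℂ L.Rel (tensorMonomial b w) := by
    intro w
    rw [tensorMonomial, map_list_prod, List.map_map]
    rfl
  have h0 : RingQuot.mkAlgHom ℂ L.Rel
      (Finsupp.linearCombination ℂ
        (fun w : {w : List ι // IsNormal π w} => tensorMonomial b w.1) l)
        = RingQuot.mkAlgHom ℂ L.Rel 0 := by
    rw [map_zero, ← AlgHom.coe_toLinearMap, LinearMap.map_finsupp_linearCombination]
    simp only [hm] at hl
    exact hl
  have h1 := straightenLin_eq hb h0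
  rw [map_zero, LinearMap.map_finsupp_linearCombination] at h1
  have hli : LinearIndependent ℂ
      fun w : {w : List ι // IsNormal π w} => Finsupp.single w.1 (1 : ℂ) :=
    (Finsupp.linearIndependent_single_one ℂ (List ι)).comp _ Subtype.val_injective
  refine linearIndependent_iff.1 hli l ?_
  rw [← h1]
  congr 2
  funext w
  simp only [Function.comp, straightenLin_tensorMonomial, straighten_of_normal L b w.2]

/-- Every monomial is a combination of normal monomials; the words that occur belong to any set of
words that contains the given one and is stable under the rewriting steps. -/
theorem monomial_mem_span (hb : ∀ i, b i ∈ L.part (π i)) {Q : List ι → Prop}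
    (hswap : ∀ u i j v, Q (u ++ i :: j :: v) → Q (u ++ j :: i :: v))
    (hbr : ∀ u i j v, Q (u ++ i :: j :: v) → ∀ k, b.repr (L.bracket (b i) (b j)) k ≠ 0 →
      Q (u ++ k :: v)) (w : List ι) (hw : Q w) :
    L.monomial b w ∈ Submodule.span ℂ {x | ∃ w, IsNormal π w ∧ Q w ∧ L.monomial b w = x} := by
  induction hn : wordMeasure w using WellFoundedLT.induction generalizing w with
  | ind n ih =>
  subst hn
  by_cases hN : IsNormal π w
  · exact Submodule.subset_span ⟨w, hN, hw, rfl⟩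
  rw [normal_iff] at hN
  push Not at hN
  obtain ⟨i, j, u, v, rfl, hij⟩ := hN
  have hbrm : L.monomial b u * L.ι (L.bracket (b i) (b j)) * L.monomial b v ∈
      Submodule.span ℂ {x | ∃ w, IsNormal π w ∧ Q w ∧ L.monomial b w = x} := by
    rw [bracket_middle]
    refine Submodule.sum_mem _ fun k hk => Submodule.smul_mem _ _ ?_
    exact ih _ (wordMeasure_of_length (by simp)) _ (hbr u i j v hw k (Finsupp.mem_support_iff.1 hk))
      rfl
  have he : L.monomial b (u ++ i :: j :: v)
      = koszul (π i) (π j) • L.monomial b (u ++ j :: i :: v)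
        + L.monomial b u * L.ι (L.bracket (b i) (b j)) * L.monomial b v := by
    have h := ι_mul_ι (hb i) (hb j)
    simp only [monomial_append, monomial_cons]
    rw [← mul_assoc (L.ι (b i)), h]
    simp only [add_mul, mul_add, smul_mul_assoc, mul_smul_comm, mul_assoc]
  rcases not_ordered_iff.1 hij with hlt | ⟨rfl, hi⟩
  · rw [he]
    exact add_mem (Submodule.smul_mem _ _ (ih _ (wordMeasure_swap hlt u v) _ (hswap _ _ _ _ hw) rfl))
      hbrm
  · rw [hi, koszul_one_one] at he
    have : L.monomial b (u ++ i :: i :: v)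
        = (1 / 2 : ℂ) • (L.monomial b u * L.ι (L.bracket (b i) (b i)) * L.monomial b v) := by
      linear_combination (norm := module) (1 / 2 : ℂ) • he
    rw [this]
    exact Submodule.smul_mem _ _ hbrm

theorem span_monomial (hb : ∀ i, b i ∈ L.part (π i)) :
    Submodule.span ℂ (Set.range fun w : {w : List ι // IsNormal π w} => L.monomial b w) = ⊤ := by
  rw [eq_top_iff]
  rintro x -
  obtain ⟨y, rfl⟩ := RingQuot.mkAlgHom_surjective ℂ L.Rel x
  induction mem_span_tensorMonomial b y using Submodule.span_induction with
  | zero => rw [map_zero]; exact zero_mem _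
  | add s s' _ _ h h' => rw [map_add]; exact add_mem h h'
  | smul r s _ h => rw [map_smul]; exact Submodule.smul_mem _ _ h
  | mem s hs =>
    obtain ⟨w, rfl⟩ := hs
    have := monomial_mem_span (L := L) hb (Q := fun _ => True) (by simp) (by simp) w trivial
    rw [tensorMonomial, map_list_prod, List.map_map]
    refine Submodule.span_mono ?_ this
    rintro _ ⟨w, hw, -, rfl⟩
    exact ⟨⟨w, hw⟩, rfl⟩

end pbw

end LieSuperalgebra

namespace GL12

open Module LieSuperalgebra

/-! ### The basis of `gl(1|2)` adapted to `osp(1|2)`. -/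

section generators

/-- The matrices `z, k, k₁, k₂, e', f', p, e, f`. -/
def gens : Fin 9 → Matrix (Fin 3) (Fin 3) ℂ :=
  ![!![1, 0, 0; 0, 1, 0; 0, 0, 1], !![0, 0, 0; 0, 1, 0; 0, 0, -1], !![0, 0, 0; 0, 0, 1; 0, 0, 0],
    !![0, 0, 0; 0, 0, 0; 0, 1, 0], !![0, 1, 0; 0, 0, 0; 1, 0, 0], !![0, 0, 1; -1, 0, 0; 0, 0, 0],
    !![2, 0, 0; 0, 1, 0; 0, 0, 1], !![0, 1, 0; 0, 0, 0; -1, 0, 0], !![0, 0, 1; 1, 0, 0; 0, 0, 0]]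

/-- The parities of the generators. -/
def genPar : Fin 9 → ZMod 2 := ![0, 0, 0, 0, 1, 1, 0, 1, 1]

/-- The coordinates of a matrix with respect to `gens`. -/
noncomputable def coords : Matrix (Fin 3) (Fin 3) ℂ ≃ₗ[ℂ] (Fin 9 → ℂ) where
  toFun X := ![X 1 1 + X 2 2 - X 0 0, (X 1 1 - X 2 2) / 2, X 1 2, X 2 1, (X 0 1 + X 2 0) / 2,
    (X 0 2 - X 1 0) / 2, X 0 0 - (X 1 1 + X 2 2) / 2, (X 0 1 - X 2 0) / 2, (X 0 2 + X 1 0) / 2]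
  invFun c := !![c 0 + 2 * c 6, c 4 + c 7, c 5 + c 8; c 8 - c 5, c 0 + c 1 + c 6, c 2;
    c 4 - c 7, c 3, c 0 - c 1 + c 6]
  map_add' X Y := by
    ext i
    fin_cases i <;> simp <;> ring
  map_smul' r X := by
    ext i
    fin_cases i <;> simp <;> ring
  left_inv X := by
    ext i j
    fin_cases i <;> fin_cases j <;> simp <;> ring
  right_inv c := by
    ext i
    fin_cases i <;> simp <;> ring

/-- The basis of `gl(1|2)` formed by `z, k, k₁, k₂, e', f', p, e, f`. -/
noncomputable def genBasis : Basis (Fin 9) ℂ (Matrix (Fin 3) (Fin 3) ℂ) := Basis.ofEquivFun coords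

theorem genBasis_apply (i : Fin 9) : genBasis i = gens i := by
  rw [genBasis, Basis.coe_ofEquivFun]
  ext a c
  fin_cases i <;> fin_cases a <;> fin_cases c <;> simp [coords, gens]

theorem genBasis_repr (X : Matrix (Fin 3) (Fin 3) ℂ) (i : Fin 9) :
    genBasis.repr X i = coords X i := by
  rw [genBasis, Basis.ofEquivFun_repr_apply]

theorem gens_mem (i : Fin 9) : gens i ∈ glPart par (genPar i) := by
  intro a c h
  revert h
  fin_cases i <;> fin_cases a <;> fin_cases c <;>
    simp [gens, genPar, par, (by decide : (1 : ZMod 2) + 1 = 0)]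

theorem genBasis_mem (i : Fin 9) : genBasis i ∈ gl12.part (genPar i) := by
  rw [genBasis_apply]
  exact gens_mem i

/-- The letters of the generators of `osp(1|2)`. -/
def IsK (i : Fin 9) : Prop := 1 ≤ i ∧ i ≤ 5

theorem gens_mem_osp {i : Fin 9} (hi : IsK i) : gens i ∈ osp12.toSubmodule := by
  change θ _ = _
  rw [θ_eq_iff]
  obtain ⟨h1, h5⟩ := hi
  have : i = 1 ∨ i = 2 ∨ i = 3 ∨ i = 4 ∨ i = 5 := by omega
  rcases this with rfl | rfl | rfl | rfl | rfl
  · exact ⟨0, 0, 1, 0, 0, by simp [gens]⟩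
  · exact ⟨0, 0, 0, 1, 0, by simp [gens]⟩
  · exact ⟨0, 0, 0, 0, 1, by simp [gens]⟩
  · exact ⟨1, 0, 0, 0, 0, by simp [gens]⟩
  · exact ⟨0, 1, 0, 0, 0, by simp [gens]⟩

theorem isK_of_repr_ne_zero {X : Matrix (Fin 3) (Fin 3) ℂ} (hX : X ∈ osp12.toSubmodule) {i : Fin 9}
    (hi : genBasis.repr X i ≠ 0) : IsK i := by
  rw [genBasis_repr] at hi
  change θ X = X at hX
  obtain ⟨x, y, u, v, w, rfl⟩ := (θ_eq_iff X).1 hX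
  revert hi
  fin_cases i <;> simp [coords, IsK]

end generators

/-! ### The PBW basis of `U(gl(1|2))`. -/

section monomials

/-- The word of a PBW monomial. -/
def word (x : PBWExponent) : List (Fin 9) :=
  List.replicate x.t 0 ++ (List.replicate x.r₁ 1 ++ List.replicate x.r₂ 2 ++ List.replicate x.r₃ 3
    ++ List.replicate (x.r₄ : ℕ) 4 ++ List.replicate (x.r₅ : ℕ) 5)
    ++ (List.replicate x.s₁ 6 ++ List.replicate (x.s₂ : ℕ) 7 ++ List.replicate (x.s₃ : ℕ) 8)

theorem ι_genBasis (i : Fin 9) : gl12.ι (genBasis i) = ![z, k, k₁, k₂, e', f', p, e, f] i := by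
  rw [genBasis_apply]
  fin_cases i <;> rfl

theorem monomial_word (x : PBWExponent) : gl12.monomial genBasis (word x) = pbw x := by
  simp [word, pbw, monomial_replicate, ι_genBasis, mul_assoc]

theorem normal_word (x : PBWExponent) : IsNormal genPar (word x) := by
  have h4 : (x.r₄ : ℕ) ≤ 1 := by omega
  have h5 : (x.r₅ : ℕ) ≤ 1 := by omega
  have h7 : (x.s₂ : ℕ) ≤ 1 := by omega
  have h8 : (x.s₃ : ℕ) ≤ 1 := by omega
  have hlt : ∀ i j : Fin 9, i < j → Ordered genPar i j := fun _ _ h => Or.inl h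
  have hev : ∀ i : Fin 9, genPar i = 0 → Ordered genPar i i := fun _ h => Or.inr ⟨rfl, h⟩
  simp only [IsNormal, word, List.pairwise_append, List.pairwise_replicate, List.mem_append,
    List.mem_replicate]
  simp only [h4, h5, h7, h8, hev 0 rfl, hev 1 rfl, hev 2 rfl, hev 3 rfl, hev 6 rfl]
  simp only [or_true, true_or, true_and]
  and_intros <;> intro a ha c hc <;> refine hlt a c ?_ <;> grind

theorem word_injective : Function.Injective word := by
  intro x y h
  have hc : ∀ i, (word x).count i = (word y).count i := fun i => by rw [h]
  have h0 := hc 0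
  have h1 := hc 1
  have h2 := hc 2
  have h3 := hc 3
  have h4 := hc 4
  have h5 := hc 5
  have h6 := hc 6
  have h7 := hc 7
  have h8 := hc 8
  simp [word, List.count_replicate] at h0 h1 h2 h3 h4 h5 h6 h7 h8
  cases x
  cases y
  simp_all [Fin.ext_iff]

/-- A sorted word is determined by its letter counts, which serve as exponents; an odd letter occurs
at most once in a normal word. -/
theorem exists_word {w : List (Fin 9)} (hw : IsNormal genPar w) : ∃ x, word x = w := by
  have hodd : ∀ i, genPar i = 1 → w.count i < 2 := by
    intro i hi
    by_contra! hc
    have hs : List.Sublist (List.replicate 2 i) w := List.replicate_sublist_iff.2 hc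
    have := hw.sublist hs
    simp [List.replicate, Ordered, hi] at this
  refine ⟨⟨w.count 0, w.count 1, w.count 2, w.count 3, ⟨w.count 4, hodd 4 rfl⟩,
    ⟨w.count 5, hodd 5 rfl⟩, w.count 6, ⟨w.count 7, hodd 7 rfl⟩, ⟨w.count 8, hodd 8 rfl⟩⟩, ?_⟩
  have hle : ∀ i j : Fin 9, Ordered genPar i j → i ≤ j := by
    rintro i j (h | ⟨rfl, -⟩)
    · exact h.le
    · exact le_rfl
  refine List.Perm.eq_of_pairwise (le := (· ≤ ·)) (fun _ _ _ _ => le_antisymm)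
    ((normal_word _).imp (hle _ _)) (hw.imp (hle _ _)) ?_
  rw [List.perm_iff_count]
  intro i
  fin_cases i <;> simp [word, List.count_replicate]

theorem hasK_iff (x : PBWExponent) : x.HasK ↔ ∃ i ∈ word x, IsK i := by
  simp only [word, PBWExponent.HasK, List.mem_append, List.mem_replicate, IsK]
  constructor
  · rintro (h | h | h | h | h)
    · exact ⟨1, by grind, by decide⟩
    · exact ⟨2, by grind, by decide⟩
    · exact ⟨3, by grind, by decide⟩
    · exact ⟨4, by grind, by decide⟩
    · exact ⟨5, by grind, by decide⟩
  · rintro ⟨i, h, h1, h5⟩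
    grind

/-- The PBW exponents correspond to the normal words. -/
noncomputable def wordEquiv : PBWExponent ≃ {w : List (Fin 9) // IsNormal genPar w} :=
  Equiv.ofBijective (fun x => ⟨word x, normal_word x⟩)
    ⟨fun _ _ h => word_injective (congrArg Subtype.val h), fun w =>
      (exists_word w.2).imp fun _ h => Subtype.ext h⟩

/-- The PBW basis of `U(gl(1|2))`. -/
noncomputable def pbwBasis : Basis PBWExponent ℂ gl12.U :=
  Basis.reindex (Basis.mk (linearIndependent_monomial genBasis_mem)
    (span_monomial genBasis_mem).ge) wordEquiv.symm

theorem pbwBasis_apply (x : PBWExponent) : pbwBasis x = pbw x := by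
  rw [pbwBasis, Basis.reindex_apply, Basis.mk_apply, ← monomial_word]
  rfl

end monomials

end GL12

namespace GL12

open Module LieSuperalgebra

/-! ### Commutation relations in `U(gl(1|2))`. -/

section relations

set_option linter.unusedSimpArgs false

theorem inc_mul_inc {a c : ZMod 2} {X Y : Matrix (Fin 3) (Fin 3) ℂ} (hX : X ∈ glPart par a)
    (hY : Y ∈ glPart par c) :
    inc X * inc Y = koszul a c • (inc Y * inc X) + inc (X * Y - koszul a c • (Y * X)) := by
  rw [← glBracket_apply par hX hY]
  exact ι_mul_ι (L := gl12) hX hY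

theorem z_eq : z = inc (gens 0) := rfl
theorem k_eq : k = inc (gens 1) := rfl
theorem k₁_eq : k₁ = inc (gens 2) := rfl
theorem k₂_eq : k₂ = inc (gens 3) := rfl
theorem e'_eq : e' = inc (gens 4) := rfl
theorem f'_eq : f' = inc (gens 5) := rfl
theorem p_eq : p = inc (gens 6) := rfl
theorem e_eq : e = inc (gens 7) := rfl
theorem f_eq : f = inc (gens 8) := rfl

theorem inc_add (X Y : Matrix (Fin 3) (Fin 3) ℂ) : inc (X + Y) = inc X + inc Y := map_add _ _ _

theorem inc_smul (r : ℂ) (X : Matrix (Fin 3) (Fin 3) ℂ) : inc (r • X) = r • inc X :=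
  map_smul _ _ _

/-- Each bracket needed below is a multiple of a single generator, so one index and one scalar
describe it; for a zero bracket the index is a placeholder. -/
theorem gens_rel (i j l : Fin 9) (r : ℂ)
    (h : gens i * gens j - koszul (genPar i) (genPar j) • (gens j * gens i) = r • gens l) :
    inc (gens i) * inc (gens j)
      = koszul (genPar i) (genPar j) • (inc (gens j) * inc (gens i)) + r • inc (gens l) := by
  rw [inc_mul_inc (gens_mem i) (gens_mem j), h, inc_smul]

theorem z_comm (i : Fin 9) : Commute z (inc (gens i)) := by
  have h := gens_rel 0 i 0 0 (by
    have : gens 0 = 1 := by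
      ext a c
      fin_cases a <;> fin_cases c <;> simp [gens]
    simp [this, genPar, koszul])
  rw [Commute, SemiconjBy]
  simpa [genPar, koszul, ← z_eq] using h

theorem z_central (u : gl12.U) : Commute z u := by
  have hu : u ∈ Submodule.span ℂ (Set.range pbwBasis) := pbwBasis.mem_span u
  induction hu using Submodule.span_induction with
  | zero => exact Commute.zero_right _
  | add _ _ _ _ h h' => exact h.add_right h'
  | smul r _ _ h => exact h.smul_right r
  | mem _ h =>
    obtain ⟨x, rfl⟩ := h
    rw [pbwBasis_apply, ← monomial_word]
    generalize word x = w
    induction w with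
    | nil => exact Commute.one_right _
    | cons i w ih =>
      rw [monomial_cons, genBasis_apply]
      exact (z_comm i).mul_right ih

theorem p_mul_e' : p * e' = e' * p + e := by
  have h := gens_rel 6 4 7 1 (by
    simp [gens, genPar, koszul, ZMod.val_one, funext_iff, Fin.forall_fin_succ]
    norm_num)
  simpa [genPar, koszul, ZMod.val_one, ← p_eq, ← e'_eq, ← e_eq] using h

theorem p_mul_f' : p * f' = f' * p + f := by
  have h := gens_rel 6 5 8 1 (by
    simp [gens, genPar, koszul, ZMod.val_one, funext_iff, Fin.forall_fin_succ]
    norm_num)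
  simpa [genPar, koszul, ZMod.val_one, ← p_eq, ← f'_eq, ← f_eq] using h

theorem p_mul_e : p * e = e * p + e' := by
  have h := gens_rel 6 7 4 1 (by
    simp [gens, genPar, koszul, ZMod.val_one, funext_iff, Fin.forall_fin_succ]
    norm_num)
  simpa [genPar, koszul, ZMod.val_one, ← p_eq, ← e'_eq, ← e_eq] using h

theorem p_mul_f : p * f = f * p + f' := by
  have h := gens_rel 6 8 5 1 (by
    simp [gens, genPar, koszul, ZMod.val_one, funext_iff, Fin.forall_fin_succ]
    norm_num)
  simpa [genPar, koszul, ZMod.val_one, ← p_eq, ← f'_eq, ← f_eq] using h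

theorem p_mul_k : p * k = k * p := by
  have h := gens_rel 6 1 0 0 (by
    ext a c
    fin_cases a <;> fin_cases c <;> simp [gens, genPar, koszul, ZMod.val_one])
  simpa [genPar, koszul, ZMod.val_one, ← p_eq, ← k_eq] using h

theorem p_mul_k₁ : p * k₁ = k₁ * p := by
  have h := gens_rel 6 2 0 0 (by
    ext a c
    fin_cases a <;> fin_cases c <;> simp [gens, genPar, koszul, ZMod.val_one])
  simpa [genPar, koszul, ZMod.val_one, ← p_eq, ← k₁_eq] using h

theorem p_mul_k₂ : p * k₂ = k₂ * p := by
  have h := gens_rel 6 3 0 0 (by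
    ext a c
    fin_cases a <;> fin_cases c <;> simp [gens, genPar, koszul, ZMod.val_one])
  simpa [genPar, koszul, ZMod.val_one, ← p_eq, ← k₂_eq] using h

theorem e_mul_k : e * k = k * e + e := by
  have h := gens_rel 7 1 7 1 (by
    simp [gens, genPar, koszul, ZMod.val_one, funext_iff, Fin.forall_fin_succ])
  simpa [genPar, koszul, ZMod.val_one, ← e_eq, ← k_eq] using h

theorem k_mul_f : k * f = f * k + f := by
  have h := gens_rel 1 8 8 1 (by
    simp [gens, genPar, koszul, ZMod.val_one, funext_iff, Fin.forall_fin_succ])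
  simpa [genPar, koszul, ZMod.val_one, ← f_eq, ← k_eq] using h

theorem e_mul_k₁ : e * k₁ = k₁ * e + f := by
  have h := gens_rel 7 2 8 1 (by
    simp [gens, genPar, koszul, ZMod.val_one, funext_iff, Fin.forall_fin_succ])
  simpa [genPar, koszul, ZMod.val_one, ← f_eq, ← k₁_eq, ← e_eq] using h

theorem e_mul_e' : e * e' = -(e' * e) := by
  have h := gens_rel 7 4 0 0 (by
    simp [gens, genPar, koszul, ZMod.val_one, funext_iff, Fin.forall_fin_succ])
  simpa [genPar, koszul, ZMod.val_one, ← e'_eq, ← e_eq] using h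

theorem e_mul_f' : e * f' = -(f' * e) - p := by
  have h := gens_rel 7 5 6 (-1) (by
    simp [gens, genPar, koszul, ZMod.val_one, funext_iff, Fin.forall_fin_succ]
    norm_num)
  simpa [genPar, koszul, ZMod.val_one, ← f'_eq, ← e_eq, ← p_eq, sub_eq_add_neg] using h

theorem f_mul_e' : f * e' = -(e' * f) + p := by
  have h := gens_rel 8 4 6 1 (by
    simp [gens, genPar, koszul, ZMod.val_one, funext_iff, Fin.forall_fin_succ]
    norm_num)
  simpa [genPar, koszul, ZMod.val_one, ← e'_eq, ← f_eq, ← p_eq] using h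

theorem f_mul_f' : f * f' = -(f' * f) := by
  have h := gens_rel 8 5 0 0 (by
    simp [gens, genPar, koszul, ZMod.val_one, funext_iff, Fin.forall_fin_succ])
  simpa [genPar, koszul, ZMod.val_one, ← f'_eq, ← f_eq] using h

theorem f_mul_e : f * e = -(e * f) + k := by
  have h := gens_rel 8 7 1 1 (by
    simp [gens, genPar, koszul, ZMod.val_one, funext_iff, Fin.forall_fin_succ])
  simpa [genPar, koszul, ZMod.val_one, ← e_eq, ← f_eq, ← k_eq] using h

theorem e'_mul_f' : e' * f' = -(f' * e') - k := by
  have h := gens_rel 4 5 1 (-1) (by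
    simp [gens, genPar, koszul, ZMod.val_one, funext_iff, Fin.forall_fin_succ])
  simpa [genPar, koszul, ZMod.val_one, ← e'_eq, ← f'_eq, ← k_eq, sub_eq_add_neg] using h

theorem eq_of_eq_neg_add {x y : gl12.U} (h : x = -x + (2 : ℂ) • y) : x = y := by
  linear_combination (norm := module) (1 / 2 : ℂ) • h

theorem e_mul_e : e * e = -k₂ := by
  have h := gens_rel 7 7 3 (-2) (by
    simp [gens, genPar, koszul, ZMod.val_one, funext_iff, Fin.forall_fin_succ]
    norm_num)
  apply eq_of_eq_neg_add
  simpa [genPar, koszul, ZMod.val_one, ← e_eq, ← k₂_eq] using h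

theorem f_mul_f : f * f = k₁ := by
  have h := gens_rel 8 8 2 2 (by
    simp [gens, genPar, koszul, ZMod.val_one, funext_iff, Fin.forall_fin_succ]
    norm_num)
  apply eq_of_eq_neg_add
  simpa [genPar, koszul, ZMod.val_one, ← f_eq, ← k₁_eq] using h

theorem e'_mul_e' : e' * e' = k₂ := by
  have h := gens_rel 4 4 3 2 (by
    simp [gens, genPar, koszul, ZMod.val_one, funext_iff, Fin.forall_fin_succ]
    norm_num)
  apply eq_of_eq_neg_add
  simpa [genPar, koszul, ZMod.val_one, ← e'_eq, ← k₂_eq] using h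

theorem f'_mul_f' : f' * f' = -k₁ := by
  have h := gens_rel 5 5 2 (-2) (by
    simp [gens, genPar, koszul, ZMod.val_one, funext_iff, Fin.forall_fin_succ]
    norm_num)
  apply eq_of_eq_neg_add
  simpa [genPar, koszul, ZMod.val_one, ← f'_eq, ← k₁_eq] using h

theorem vK_eq (a b : ℂ) : vK a b = a • e' + b • f' := by
  rw [e'_eq, f'_eq, ← inc_smul, ← inc_smul, ← inc_add, vK]
  congr 1
  ext i j
  fin_cases i <;> fin_cases j <;> simp [gens]

theorem vP_eq (a b : ℂ) : vP a b = a • e + b • f := by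
  rw [e_eq, f_eq, ← inc_smul, ← inc_smul, ← inc_add, vP]
  congr 1
  ext i j
  fin_cases i <;> fin_cases j <;> simp [gens]

theorem vK_one_zero : vK 1 0 = e' := by simp [vK_eq]
theorem vK_zero_one : vK 0 1 = f' := by simp [vK_eq]
theorem vP_one_zero : vP 1 0 = e := by simp [vP_eq]
theorem vP_zero_one : vP 0 1 = f := by simp [vP_eq]

theorem p_mul_vK (a b : ℂ) : p * vK a b = vK a b * p + vP a b := by
  rw [vK_eq, vP_eq]
  simp only [mul_add, add_mul, mul_smul_comm, smul_mul_assoc, p_mul_e', p_mul_f', smul_add]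
  abel

theorem vP_mul_p (a b : ℂ) : vP a b * p = p * vP a b - vK a b := by
  rw [vK_eq, vP_eq]
  simp only [mul_add, add_mul, mul_smul_comm, smul_mul_assoc, p_mul_e, p_mul_f, smul_add]
  abel

end relations

/-! ### Existence and uniqueness of the polynomials `α` and `β`. -/

section alphaBeta

/-- Passing from `n` to `n + 1` creates the term `β(p) v_k`, which has to be expanded again. The
degree bound ensures that only powers below `p ^ n` occur in it, so strong induction applies. -/
theorem exists_alpha_beta (n : ℕ) : ∃ α β : ℂ[X], β ∈ degreeLT ℂ n ∧
    ∀ a b : ℂ, p ^ n * vK a b = vK a b * aeval p α + aeval p β * vP a b := by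
  induction n using Nat.strong_induction_on with
  | _ n ih =>
  rcases n with _ | n
  · exact ⟨1, 0, zero_mem _, fun a b => by simp⟩
  obtain ⟨α, β, hβ, h⟩ := ih n n.lt_succ_self
  have key : ∃ A B : ℂ[X], B ∈ degreeLT ℂ n ∧
      ∀ a b : ℂ, aeval p β * vK a b = vK a b * aeval p A + aeval p B * vP a b := by
    rw [degreeLT_eq_span_X_pow] at hβ
    clear h
    induction hβ using Submodule.span_induction with
    | zero => exact ⟨0, 0, zero_mem _, fun a b => by simp⟩
    | add q q' _ _ h h' =>
      obtain ⟨A, B, hB, h⟩ := h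
      obtain ⟨A', B', hB', h'⟩ := h'
      refine ⟨A + A', B + B', add_mem hB hB', fun a b => ?_⟩
      simp only [map_add, add_mul, mul_add, h, h']
      abel
    | smul r q _ h =>
      obtain ⟨A, B, hB, h⟩ := h
      refine ⟨r • A, r • B, Submodule.smul_mem _ _ hB, fun a b => ?_⟩
      simp only [map_smul, smul_mul_assoc, mul_smul_comm, h, smul_add]
    | mem q hq =>
      simp only [Finset.coe_image, Finset.coe_range, Set.mem_image, Set.mem_Iio] at hq
      obtain ⟨i, hi, rfl⟩ := hq
      obtain ⟨A, B, hB, h⟩ := ih i (by omega)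
      refine ⟨A, B, degreeLT_mono hi.le hB, fun a b => ?_⟩
      rw [map_pow, aeval_X, h]
  obtain ⟨A, B, hB, h'⟩ := key
  -- Read off from `p v_k = v_k p + v_p` and `v_p p = p v_p - v_k`, where `A` and `B` expand `β(p)
  -- v_k`.
  refine ⟨α * X - A, β * X + X ^ n - B, ?_, fun a b => ?_⟩
  · refine sub_mem (add_mem ?_ ?_) (degreeLT_mono n.le_succ hB)
    · rw [mem_degreeLT] at hβ ⊢
      rw [degree_mul, degree_X]
      push_cast
      exact WithBot.add_lt_add_right (by simp) hβ
    · rw [mem_degreeLT, degree_X_pow]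
      exact_mod_cast n.lt_succ_self
  · calc p ^ (n + 1) * vK a b = p ^ n * vK a b * p + p ^ n * vP a b := by
          rw [pow_succ, mul_assoc, p_mul_vK]; noncomm_ring
      _ = vK a b * (aeval p α * p) + aeval p β * (vP a b * p) + p ^ n * vP a b := by
          rw [h]; noncomm_ring
      _ = vK a b * (aeval p α * p) + aeval p β * p * vP a b - aeval p β * vK a b
            + p ^ n * vP a b := by
          rw [vP_mul_p]; noncomm_ring
      _ = _ := by
          rw [h']
          simp only [map_sub, map_add, map_mul, map_pow, aeval_X]
          noncomm_ring

theorem pbw_e' (n : ℕ) : pbw ⟨0, 0, 0, 0, 1, 0, n, 0, 0⟩ = e' * p ^ n := by simp [pbw]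

theorem pbw_e (m n : ℕ) : pbw ⟨m, 0, 0, 0, 0, 0, n, 1, 0⟩ = z ^ m * p ^ n * e := by simp [pbw]

theorem pbw_f (m n : ℕ) : pbw ⟨m, 0, 0, 0, 0, 0, n, 0, 1⟩ = z ^ m * p ^ n * f := by simp [pbw]

theorem pbw_ef (m n : ℕ) : pbw ⟨m, 0, 0, 0, 0, 0, n, 1, 1⟩ = z ^ m * p ^ n * e * f := by
  simp [pbw]

theorem pbw_p (m n : ℕ) : pbw ⟨m, 0, 0, 0, 0, 0, n, 0, 0⟩ = z ^ m * p ^ n := by simp [pbw]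

/-- The elements `e' p^i` and `p^j e` are pairwise distinct PBW monomials. Thus the relation for the
single vector `(1, 0)` already forces uniqueness. -/
theorem eq_zero_of_e'_mul_add_mul_e {A B : ℂ[X]} (h : e' * aeval p A + aeval p B * e = 0) :
    A = 0 ∧ B = 0 := by
  classical
  have hA : ∀ x, pbwBasis.repr (e' * aeval p A) x = ∑ i ∈ Finset.range (A.natDegree + 1),
      A.coeff i * Finsupp.single ⟨0, 0, 0, 0, 1, 0, i, 0, 0⟩ (1 : ℂ) x := by
    intro x
    rw [aeval_eq_sum_range, Finset.mul_sum, map_sum, Finsupp.finsetSum_apply]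
    refine Finset.sum_congr rfl fun i _ => ?_
    rw [mul_smul_comm, ← pbw_e', ← pbwBasis_apply, map_smul, Basis.repr_self, Finsupp.smul_apply,
      smul_eq_mul]
  have hB : ∀ x, pbwBasis.repr (aeval p B * e) x = ∑ i ∈ Finset.range (B.natDegree + 1),
      B.coeff i * Finsupp.single ⟨0, 0, 0, 0, 0, 0, i, 1, 0⟩ (1 : ℂ) x := by
    intro x
    rw [aeval_eq_sum_range, Finset.sum_mul, map_sum, Finsupp.finsetSum_apply]
    refine Finset.sum_congr rfl fun i _ => ?_
    have hi : p ^ i * e = pbwBasis ⟨0, 0, 0, 0, 0, 0, i, 1, 0⟩ := by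
      rw [pbwBasis_apply, pbw_e, pow_zero, one_mul]
    rw [smul_mul_assoc, hi, map_smul, Basis.repr_self, Finsupp.smul_apply, smul_eq_mul]
  have hx : ∀ x, pbwBasis.repr (e' * aeval p A) x + pbwBasis.repr (aeval p B * e) x = 0 := by
    intro x
    rw [← Finsupp.add_apply, ← map_add, h, map_zero, Finsupp.zero_apply]
  have hcoeff : ∀ (q : ℂ[X]) (j : ℕ), (j < q.natDegree + 1 → q.coeff j = 0) → q.coeff j = 0 := by
    intro q j h
    by_cases hj : j < q.natDegree + 1
    · exact h hj
    · exact coeff_eq_zero_of_natDegree_lt (by omega)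
  constructor
  · ext j
    have := hx ⟨0, 0, 0, 0, 1, 0, j, 0, 0⟩
    rw [hA, hB] at this
    simp [Finsupp.single_apply] at this
    exact hcoeff A j fun h => this (by omega)
  · ext j
    have := hx ⟨0, 0, 0, 0, 0, 0, j, 1, 0⟩
    rw [hA, hB] at this
    simp [Finsupp.single_apply] at this
    exact hcoeff B j fun h => this (by omega)

theorem existsUnique_alphaBeta :
    ∃! αβ : (ℕ → ℂ[X]) × (ℕ → ℂ[X]), IsAlphaBeta αβ.1 αβ.2 := by
  choose α β _ h using exists_alpha_beta
  refine ⟨(α, β), h, ?_⟩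
  rintro ⟨α', β'⟩ h'
  have key : ∀ n, α' n - α n = 0 ∧ β' n - β n = 0 := by
    intro n
    apply eq_zero_of_e'_mul_add_mul_e
    have h1 := h n 1 0
    have h2 := h' n 1 0
    rw [h1, vK_one_zero, vP_one_zero] at h2
    simp only [map_sub, mul_sub, sub_mul]
    linear_combination (norm := abel) -h2
  exact Prod.ext (funext fun n => sub_eq_zero.1 (key n).1) (funext fun n => sub_eq_zero.1 (key n).2)

end alphaBeta

end GL12

namespace GL12

open Module LieSuperalgebra

/-! ### The right ideal `k U(g)`. -/

section rightIdeal

/-- The right ideal `k U(g)`. -/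
noncomputable def kU : Submodule ℂ gl12.U := osp12.toSubmodule.map gl12.ι * ⊤

instance (i : Fin 9) : Decidable (IsK i) := inferInstanceAs (Decidable (_ ∧ _))

theorem mul_mem_kU {i : Fin 9} (hi : IsK i) (u : gl12.U) : inc (gens i) * u ∈ kU :=
  Submodule.mul_mem_mul ⟨_, gens_mem_osp hi, rfl⟩ trivial

theorem kU_mul_mem {x : gl12.U} (hx : x ∈ kU) (u : gl12.U) : x * u ∈ kU := by
  have := Submodule.mul_mem_mul hx (Submodule.mem_top (R := ℂ) (x := u))
  rw [kU, mul_assoc] at this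
  have hle : osp12.toSubmodule.map gl12.ι * (⊤ * ⊤) ≤ kU := mul_le_mul' le_rfl le_top
  exact hle this

theorem z_pow_mul_mem_kU (m : ℕ) {x : gl12.U} (hx : x ∈ kU) : z ^ m * x ∈ kU := by
  refine Submodule.mul_induction_on hx ?_ fun x y hx hy => ?_
  · intro y hy u _
    rw [← mul_assoc, ((z_central y).pow_left m).eq, mul_assoc]
    exact Submodule.mul_mem_mul hy trivial
  · rw [mul_add]
    exact add_mem hx hy

/-- The letters of the `osp(1|2)`-part of the word of a PBW monomial. -/
def kWord (x : PBWExponent) : List (Fin 9) :=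
  List.replicate x.r₁ 1 ++ List.replicate x.r₂ 2 ++ List.replicate x.r₃ 3
    ++ List.replicate (x.r₄ : ℕ) 4 ++ List.replicate (x.r₅ : ℕ) 5

/-- The letters of the remaining part of the word of a PBW monomial. -/
def pWord (x : PBWExponent) : List (Fin 9) :=
  List.replicate x.s₁ 6 ++ List.replicate (x.s₂ : ℕ) 7 ++ List.replicate (x.s₃ : ℕ) 8

theorem word_eq (x : PBWExponent) : word x = List.replicate x.t 0 ++ kWord x ++ pWord x := rfl

theorem isK_of_mem_kWord {x : PBWExponent} {i : Fin 9} (hi : i ∈ kWord x) : IsK i := by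
  simp only [kWord, List.mem_append, List.mem_replicate] at hi
  constructor <;> grind

theorem lt_of_mem_pWord {x : PBWExponent} {i : Fin 9} (hi : i ∈ pWord x) : 5 < i := by
  simp only [pWord, List.mem_append, List.mem_replicate] at hi
  grind

theorem pbw_mem_kU {x : PBWExponent} (hx : x.HasK) : pbw x ∈ kU := by
  rw [hasK_iff, word_eq] at hx
  obtain ⟨i, hi, hK⟩ := hx
  have hne : kWord x ≠ [] := by
    intro h0
    rw [h0, List.append_nil, List.mem_append, List.mem_replicate] at hi
    rcases hi with ⟨-, rfl⟩ | hi
    · exact absurd hK (by simp [IsK])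
    · exact absurd hK.2 (lt_of_mem_pWord hi).not_ge
  obtain ⟨j, w, hw⟩ := List.exists_cons_of_ne_nil hne
  have hj : IsK j := isK_of_mem_kWord (x := x) (by simp [hw])
  rw [← monomial_word, word_eq, hw, monomial_append, monomial_append, monomial_cons,
    monomial_replicate, ι_genBasis 0, genBasis_apply, mul_assoc, mul_assoc]
  exact z_pow_mul_mem_kU _ (mul_mem_kU hj _)

/-- The new letter passes the central `z` and joins the `osp(1|2)`-block. Straightening that block
yields only non-empty words in the same letters, because `osp(1|2)` is closed under the bracket, and
the other two blocks stay untouched. -/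
theorem mul_pbw_mem_span {i : Fin 9} (hi : IsK i) (x : PBWExponent) :
    inc (gens i) * pbw x ∈ Submodule.span ℂ (pbw '' {y | y.HasK}) := by
  have hspan := monomial_mem_span (L := gl12) (b := genBasis) genBasis_mem
    (Q := fun w => w ≠ [] ∧ ∀ j ∈ w, IsK j)
    (by
      rintro u a c v ⟨-, h⟩
      exact ⟨by simp, fun j hj => h j (by simp only [List.mem_append, List.mem_cons] at hj ⊢; tauto)⟩)
    (by
      rintro u a c v ⟨-, h⟩ l hl
      refine ⟨by simp, fun j hj => ?_⟩
      simp only [List.mem_append, List.mem_cons] at h hj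
      rcases hj with hj | rfl | hj
      · exact h j (by tauto)
      · refine isK_of_repr_ne_zero (osp12.bracket_mem _ ?_ _ ?_) hl <;> rw [genBasis_apply]
        · exact gens_mem_osp (h a (by tauto))
        · exact gens_mem_osp (h c (by tauto))
      · exact h j (by tauto))
    (i :: kWord x) ⟨by simp, by
      intro j hj
      rcases List.mem_cons.1 hj with rfl | hj
      · exact hi
      · exact isK_of_mem_kWord hj⟩
  have he : inc (gens i) * pbw x = z ^ x.t * gl12.monomial genBasis (i :: kWord x)
      * gl12.monomial genBasis (pWord x) := by
    rw [← monomial_word, word_eq, monomial_append, monomial_append, monomial_replicate, ι_genBasis,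
      monomial_cons, genBasis_apply, ← mul_assoc, ← mul_assoc, ← mul_assoc]
    congr 2
    exact ((z_central _).pow_left _).symm.eq
  rw [he]
  generalize gl12.monomial genBasis (i :: kWord x) = q at hspan
  induction hspan using Submodule.span_induction with
  | zero => simp
  | add a c _ _ h h' => rw [mul_add, add_mul]; exact add_mem h h'
  | smul r a _ h => rw [mul_smul_comm, smul_mul_assoc]; exact Submodule.smul_mem _ _ h
  | mem a h =>
    obtain ⟨w, hw, ⟨hne, hwK⟩, rfl⟩ := h
    have hN : IsNormal genPar (List.replicate x.t 0 ++ w ++ pWord x) := by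
      have h := normal_word x
      rw [word_eq, IsNormal, List.pairwise_append, List.pairwise_append] at h
      rw [IsNormal, List.pairwise_append, List.pairwise_append]
      refine ⟨⟨h.1.1, hw, fun a ha c hc => Or.inl ?_⟩, h.2.1, fun a ha c hc => ?_⟩
      · rw [(List.mem_replicate.1 ha).2]
        exact lt_of_lt_of_le (by decide) (hwK c hc).1
      · rcases List.mem_append.1 ha with ha | ha
        · exact h.2.2 a (List.mem_append_left _ ha) c hc
        · exact Or.inl ((hwK a ha).2.trans_lt (lt_of_mem_pWord hc))
    obtain ⟨y, hy⟩ := exists_word hN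
    refine Submodule.subset_span ⟨y, ?_, ?_⟩
    · obtain ⟨j, w', rfl⟩ := List.exists_cons_of_ne_nil hne
      exact (hasK_iff y).2 ⟨j, by simp [hy], hwK j (by simp)⟩
    · rw [← monomial_word, hy, monomial_append, monomial_append, monomial_replicate, ι_genBasis]
      rfl

/-- The PBW monomials with a factor in `osp(1|2)` span the right ideal `k U(g)`. -/
theorem kU_le_span : kU ≤ Submodule.span ℂ (pbw '' {y | y.HasK}) := by
  rw [kU, Submodule.mul_le]
  rintro _ ⟨X, hX, rfl⟩ u -
  have hu : u ∈ Submodule.span ℂ (Set.range pbwBasis) := pbwBasis.mem_span u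
  induction hu using Submodule.span_induction with
  | zero => simp
  | add a c _ _ h h' => rw [mul_add]; exact add_mem h h'
  | smul r a _ h => rw [mul_smul_comm]; exact Submodule.smul_mem _ _ h
  | mem a h =>
    obtain ⟨x, rfl⟩ := h
    rw [pbwBasis_apply, ← genBasis.linearCombination_repr X, Finsupp.linearCombination_apply,
      Finsupp.sum, map_sum, Finset.sum_mul]
    refine Submodule.sum_mem _ fun i hi => ?_
    rw [map_smul, smul_mul_assoc, genBasis_apply]
    exact Submodule.smul_mem _ _
      (mul_pbw_mem_span (isK_of_repr_ne_zero hX (Finsupp.mem_support_iff.1 hi)) x)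

end rightIdeal

/-! ### The span of the basis vectors is the subspace `k U(g) + U(g) k`. -/

section spanning

variable {α β' : ℕ → ℂ[X]}

theorem kU_le_span_basisVec : kU ≤ Submodule.span ℂ (Set.range (basisVec β')) := by
  refine kU_le_span.trans (Submodule.span_mono ?_)
  rintro _ ⟨x, hx, rfl⟩
  exact ⟨.mono x hx, rfl⟩

/-- The elements all of whose multiples by powers of `z` lie in the span of the basis vectors. -/
noncomputable def zSpan (β' : ℕ → ℂ[X]) : Submodule ℂ gl12.U :=
  ⨅ m : ℕ, (Submodule.span ℂ (Set.range (basisVec β'))).comap (LinearMap.mulLeft ℂ (z ^ m))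

theorem mem_zSpan {x : gl12.U} :
    x ∈ zSpan β' ↔ ∀ m : ℕ, z ^ m * x ∈ Submodule.span ℂ (Set.range (basisVec β')) := by
  simp [zSpan]

theorem kU_le_zSpan : kU ≤ zSpan β' := fun _ hx => mem_zSpan.2 fun m =>
  kU_le_span_basisVec (z_pow_mul_mem_kU m hx)

theorem p_pow_mul_e_mem (n : ℕ) : p ^ n * e ∈ zSpan β' := mem_zSpan.2 fun m =>
  Submodule.subset_span ⟨.pe m n, by rw [basisVec, mul_assoc]⟩

theorem p_pow_mul_f_mem (n : ℕ) : p ^ n * f ∈ zSpan β' := mem_zSpan.2 fun m =>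
  Submodule.subset_span ⟨.pf m n, by rw [basisVec, mul_assoc]⟩

theorem beta_mem (n : ℕ) : aeval p (β' n) * e * f - p ^ (n + 1) ∈ zSpan β' := mem_zSpan.2 fun m =>
  Submodule.subset_span ⟨.beta m n, by rw [basisVec, mul_sub, ← mul_assoc, ← mul_assoc]⟩

theorem aeval_mul_mem {N : Submodule ℂ gl12.U} {y : gl12.U} (h : ∀ n : ℕ, p ^ n * y ∈ N)
    (q : ℂ[X]) : aeval p q * y ∈ N := by
  rw [aeval_eq_sum_range, Finset.sum_mul]
  refine Submodule.sum_mem _ fun i _ => ?_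
  rw [smul_mul_assoc]
  exact Submodule.smul_mem _ _ (h i)

/-- Applied to `k, k₁, k₂`, which commute with `p` and can therefore be moved to the far left, into
`k U(g)`. -/
theorem commute_aeval {x : gl12.U} (h : p * x = x * p) (q : ℂ[X]) :
    aeval p q * x = x * aeval p q := by
  have hc : Commute p x := h
  exact (aeval_mul_mem (N := LinearMap.eqLocus
    (LinearMap.mulRight ℂ x) (LinearMap.mulLeft ℂ x)) (y := 1)
    (fun n => by simpa using (hc.pow_left n).eq) q |> fun h => by simpa using h)

theorem IsAlphaBeta.e' (h : IsAlphaBeta α β') (n : ℕ) :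
    p ^ n * GL12.e' = GL12.e' * aeval p (α n) + aeval p (β' n) * e := by
  simpa only [vK_one_zero, vP_one_zero] using h n 1 0

theorem IsAlphaBeta.f' (h : IsAlphaBeta α β') (n : ℕ) :
    p ^ n * GL12.f' = GL12.f' * aeval p (α n) + aeval p (β' n) * f := by
  simpa only [vK_zero_one, vP_zero_one] using h n 0 1

theorem e'_mul_mem (u : gl12.U) : e' * u ∈ zSpan β' :=
  kU_le_zSpan (mul_mem_kU (i := 4) (by decide) u)

theorem f'_mul_mem (u : gl12.U) : f' * u ∈ zSpan β' :=
  kU_le_zSpan (mul_mem_kU (i := 5) (by decide) u)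

theorem k_mul_mem (u : gl12.U) : k * u ∈ zSpan β' :=
  kU_le_zSpan (mul_mem_kU (i := 1) (by decide) u)

theorem k₁_mul_mem (u : gl12.U) : k₁ * u ∈ zSpan β' :=
  kU_le_zSpan (mul_mem_kU (i := 2) (by decide) u)

theorem k₂_mul_mem (u : gl12.U) : k₂ * u ∈ zSpan β' :=
  kU_le_zSpan (mul_mem_kU (i := 3) (by decide) u)


/-- Moving `e'` left past `f` and `e` and then through `p ^ n` leaves terms of `k U(g)`, vectors of
family (i) and, for `p ^ n * f * e'`, the negative of a vector of family (ii): the power `p ^ (n +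
1)` comes from `[f, e'] = p`. -/
theorem p_pow_mul_mul_e'_mem (h : IsAlphaBeta α β') (n : ℕ) (s₂ s₃ : Fin 2) :
    p ^ n * e ^ (s₂ : ℕ) * f ^ (s₃ : ℕ) * e' ∈ zSpan β' := by
  have h0 : p ^ n * e' ∈ zSpan β' := by
    rw [h.e']
    exact add_mem (e'_mul_mem _) (aeval_mul_mem p_pow_mul_e_mem _)
  obtain h2 | h2 : (s₂ : ℕ) = 0 ∨ (s₂ : ℕ) = 1 := by omega
  all_goals obtain h3 | h3 : (s₃ : ℕ) = 0 ∨ (s₃ : ℕ) = 1 := by omega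
  all_goals simp only [h2, h3, pow_zero, pow_one, mul_one]
  · exact h0
  · have : p ^ n * f * e' = -(e' * (aeval p (α n) * f))
        - (aeval p (β' n) * e * f - p ^ (n + 1)) := by
      rw [mul_assoc, f_mul_e', mul_add, mul_neg, ← mul_assoc, h.e', pow_succ]
      noncomm_ring
    rw [this]
    exact sub_mem (neg_mem (e'_mul_mem _)) (beta_mem n)
  · have : p ^ n * e * e' = -(e' * (aeval p (α n) * e)) + k₂ * aeval p (β' n) := by
      rw [mul_assoc, e_mul_e', mul_neg, ← mul_assoc, h.e', add_mul, mul_assoc (aeval p (β' n)),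
        e_mul_e, ← commute_aeval p_mul_k₂]
      noncomm_ring
    rw [this]
    exact add_mem (neg_mem (e'_mul_mem _)) (k₂_mul_mem _)
  · have : p ^ n * e * f * e' = e' * (aeval p (α n) * e * f) - k₂ * (aeval p (β' n) * f)
        + p ^ (n + 1) * e - p ^ n * e' := by
      calc p ^ n * e * f * e' = p ^ n * e * (f * e') := by noncomm_ring
        _ = -(p ^ n * (e * e') * f) + p ^ n * (e * p) := by rw [f_mul_e']; noncomm_ring
        _ = p ^ n * e' * (e * f) + p ^ n * (p * e - e') := by
          rw [e_mul_e', show e * p = p * e - e' by rw [p_mul_e]; abel]; noncomm_ring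
        _ = e' * (aeval p (α n) * e * f) + aeval p (β' n) * (e * e) * f
            + p ^ (n + 1) * e - p ^ n * e' := by
          nth_rewrite 1 [h.e']
          rw [pow_succ]
          noncomm_ring
        _ = _ := by
          rw [e_mul_e, mul_neg, commute_aeval p_mul_k₂]; noncomm_ring
    rw [this]
    exact sub_mem (add_mem (sub_mem (e'_mul_mem _) (k₂_mul_mem _)) (p_pow_mul_e_mem _)) h0

/-- The same computation with `[e, f'] = -p`; here family (ii) arises from `p ^ n * e * f'`, and
reordering `f e` contributes additional terms with `k`. -/
theorem p_pow_mul_mul_f'_mem (h : IsAlphaBeta α β') (n : ℕ) (s₂ s₃ : Fin 2) :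
    p ^ n * e ^ (s₂ : ℕ) * f ^ (s₃ : ℕ) * f' ∈ zSpan β' := by
  obtain h2 | h2 : (s₂ : ℕ) = 0 ∨ (s₂ : ℕ) = 1 := by omega
  all_goals obtain h3 | h3 : (s₃ : ℕ) = 0 ∨ (s₃ : ℕ) = 1 := by omega
  all_goals simp only [h2, h3, pow_zero, pow_one, mul_one]
  · rw [h.f']
    exact add_mem (f'_mul_mem _) (aeval_mul_mem p_pow_mul_f_mem _)
  · have : p ^ n * f * f' = -(f' * (aeval p (α n) * f)) - k₁ * aeval p (β' n) := by
      rw [mul_assoc, f_mul_f', mul_neg, ← mul_assoc, h.f', add_mul, mul_assoc (aeval p (β' n)),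
        f_mul_f, ← commute_aeval p_mul_k₁]
      noncomm_ring
    rw [this]
    exact sub_mem (neg_mem (f'_mul_mem _)) (k₁_mul_mem _)
  · have : p ^ n * e * f' = -(f' * (aeval p (α n) * e)) - k * aeval p (β' n)
        + (aeval p (β' n) * e * f - p ^ (n + 1)) := by
      rw [mul_assoc, e_mul_f', mul_sub, mul_neg, ← mul_assoc, h.f', add_mul,
        mul_assoc (aeval p (β' n)), f_mul_e, ← commute_aeval p_mul_k, pow_succ]
      noncomm_ring
    rw [this]
    exact add_mem (sub_mem (neg_mem (f'_mul_mem _)) (k_mul_mem _)) (beta_mem n)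
  · have : p ^ n * e * f * f' = f' * (aeval p (α n) * e * f) - k₁ * (aeval p (β' n) * e)
        - aeval p (β' n) * f + k * (aeval p (β' n) * f) + p ^ (n + 1) * f := by
      calc p ^ n * e * f * f' = p ^ n * e * (f * f') := by noncomm_ring
        _ = -(p ^ n * (e * f') * f) := by rw [f_mul_f']; noncomm_ring
        _ = p ^ n * f' * (e * f) + p ^ n * p * f := by rw [e_mul_f']; noncomm_ring
        _ = f' * (aeval p (α n) * e * f) + aeval p (β' n) * (f * e) * f
            + p ^ (n + 1) * f := by rw [h.f', pow_succ]; noncomm_ring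
        _ = f' * (aeval p (α n) * e * f) - aeval p (β' n) * (e * (f * f))
            + aeval p (β' n) * k * f + p ^ (n + 1) * f := by rw [f_mul_e]; noncomm_ring
        _ = f' * (aeval p (α n) * e * f) - aeval p (β' n) * k₁ * e - aeval p (β' n) * f
            + aeval p (β' n) * k * f + p ^ (n + 1) * f := by
          rw [f_mul_f, e_mul_k₁]; noncomm_ring
        _ = _ := by
          rw [commute_aeval p_mul_k₁, commute_aeval p_mul_k]; noncomm_ring
    rw [this]
    exact add_mem (add_mem (sub_mem (sub_mem (f'_mul_mem _) (k₁_mul_mem _))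
      (aeval_mul_mem p_pow_mul_f_mem _)) (k_mul_mem _)) (p_pow_mul_f_mem _)

/-- A left factor that has a letter of `osp(1|2)` keeps the product in the right ideal `k U(g)`, so
only the monomials in `z, p, e, f` need checking. -/
theorem mul_mem_span_basisVec {y : gl12.U}
    (hy : ∀ (n : ℕ) (s₂ s₃ : Fin 2), p ^ n * e ^ (s₂ : ℕ) * f ^ (s₃ : ℕ) * y ∈ zSpan β')
    (u : gl12.U) : u * y ∈ Submodule.span ℂ (Set.range (basisVec β')) := by
  have hu : u ∈ Submodule.span ℂ (Set.range pbwBasis) := pbwBasis.mem_span u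
  induction hu using Submodule.span_induction with
  | zero => simp
  | add a c _ _ h h' => rw [add_mul]; exact add_mem h h'
  | smul r a _ h => rw [smul_mul_assoc]; exact Submodule.smul_mem _ _ h
  | mem a h =>
    obtain ⟨x, rfl⟩ := h
    rw [pbwBasis_apply]
    by_cases hx : x.HasK
    · exact kU_le_span_basisVec (kU_mul_mem (pbw_mem_kU hx) y)
    · obtain ⟨t, r₁, r₂, r₃, r₄, r₅, s₁, s₂, s₃⟩ := x
      simp only [PBWExponent.HasK, not_or, not_le, Nat.lt_one_iff] at hx
      obtain ⟨rfl, rfl, rfl, h4, h5⟩ := hx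
      have := mem_zSpan.1 (hy s₁ s₂ s₃) t
      simpa only [pbw, h4, h5, pow_zero, mul_one, mul_assoc] using this

theorem biIdeal_le_span (h : IsAlphaBeta α β') :
    biIdeal osp12 ≤ Submodule.span ℂ (Set.range (basisVec β')) := by
  have he := mul_mem_span_basisVec (p_pow_mul_mul_e'_mem h)
  have hf := mul_mem_span_basisVec (p_pow_mul_mul_f'_mem h)
  refine sup_le kU_le_span_basisVec ?_
  rw [Submodule.mul_le]
  rintro u - _ ⟨X, hX, rfl⟩
  rw [← genBasis.linearCombination_repr X, Finsupp.linearCombination_apply,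
    Finsupp.sum, map_sum, Finset.mul_sum]
  refine Submodule.sum_mem _ fun i hi => ?_
  rw [map_smul, mul_smul_comm, ι_genBasis]
  refine Submodule.smul_mem _ _ ?_
  have hK := isK_of_repr_ne_zero hX (Finsupp.mem_support_iff.1 hi)
  clear hi
  have : i = 1 ∨ i = 2 ∨ i = 3 ∨ i = 4 ∨ i = 5 := by
    obtain ⟨h1, h5⟩ := hK
    omega
  rcases this with rfl | rfl | rfl | rfl | rfl
  -- The even generators are quadratic in the odd ones, so `U(g) k` reduces to right multiples by
  -- `e'` and `f'`.
  · have : u * k = -(u * f' * e') - u * e' * f' := by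
      rw [mul_assoc u e', e'_mul_f']; noncomm_ring
    change u * k ∈ _
    rw [this]
    exact sub_mem (neg_mem (he _)) (hf _)
  · have : u * k₁ = -(u * f' * f') := by rw [mul_assoc, f'_mul_f']; noncomm_ring
    change u * k₁ ∈ _
    rw [this]
    exact neg_mem (hf _)
  · have : u * k₂ = u * e' * e' := by rw [mul_assoc, e'_mul_e']
    change u * k₂ ∈ _
    rw [this]
    exact he _
  · exact he u
  · exact hf u

theorem inc_mul_mem_biIdeal {i : Fin 9} (hi : IsK i) (u : gl12.U) :
    inc (gens i) * u ∈ biIdeal osp12 :=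
  Submodule.mem_sup_left (mul_mem_kU hi u)

theorem mul_inc_mem_biIdeal {i : Fin 9} (hi : IsK i) (u : gl12.U) :
    u * inc (gens i) ∈ biIdeal osp12 :=
  Submodule.mem_sup_right (Submodule.mul_mem_mul trivial ⟨_, gens_mem_osp hi, rfl⟩)

theorem span_le_biIdeal (h : IsAlphaBeta α β') :
    Submodule.span ℂ (Set.range (basisVec β')) ≤ biIdeal osp12 := by
  rw [Submodule.span_le]
  rintro _ ⟨i, rfl⟩
  have hz : ∀ m u, z ^ m * u = u * z ^ m := fun m u => ((z_central u).pow_left m).eq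
  match i with
  | .pe m n =>
    -- Since `[e, k] = e` and `z, p` commute with `k`, the vector is its own commutator with `k`.
    have : z ^ m * p ^ n * e = z ^ m * p ^ n * e * k - k * (z ^ m * p ^ n * e) := by
      have hpk : p ^ n * k = k * p ^ n := ((show Commute p k from p_mul_k).pow_left n).eq
      rw [mul_assoc _ e, e_mul_k, mul_add, ← mul_assoc _ k, mul_assoc _ _ k, hpk,
        ← mul_assoc (z ^ m), hz m k]
      noncomm_ring
    rw [basisVec, this]
    exact sub_mem (mul_inc_mem_biIdeal (i := 1) (by decide) _)
      (inc_mul_mem_biIdeal (i := 1) (by decide) _)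
  | .pf m n =>
    have : z ^ m * p ^ n * f = k * (z ^ m * p ^ n * f) - z ^ m * p ^ n * f * k := by
      have hpk : p ^ n * k = k * p ^ n := ((show Commute p k from p_mul_k).pow_left n).eq
      rw [← mul_assoc k, ← mul_assoc k, ← hz m k, mul_assoc _ k, ← hpk, ← mul_assoc (z ^ m),
        mul_assoc _ k, k_mul_f]
      noncomm_ring
    rw [basisVec, this]
    exact sub_mem (inc_mul_mem_biIdeal (i := 1) (by decide) _)
      (mul_inc_mem_biIdeal (i := 1) (by decide) _)
  | .beta m n =>
    -- This is the expansion of `p ^ n * e * f'` solved for the vector of family (ii), then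
    -- multiplied by `z ^ m`.
    have : z ^ m * aeval p (β' n) * e * f - z ^ m * p ^ (n + 1)
        = z ^ m * p ^ n * e * f' + f' * (z ^ m * aeval p (α n) * e)
          + k * (z ^ m * aeval p (β' n)) := by
      have h1 : p ^ n * e * f' = -(f' * (aeval p (α n) * e)) - k * aeval p (β' n)
          + (aeval p (β' n) * e * f - p ^ (n + 1)) := by
        rw [mul_assoc, e_mul_f', mul_sub, mul_neg, ← mul_assoc, h.f', add_mul,
          mul_assoc (aeval p (β' n)), f_mul_e, ← commute_aeval p_mul_k, pow_succ]
        noncomm_ring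
      rw [show z ^ m * p ^ n * e * f' = z ^ m * (p ^ n * e * f') by noncomm_ring, h1,
        show f' * (z ^ m * aeval p (α n) * e) = z ^ m * (f' * (aeval p (α n) * e)) by
          rw [mul_assoc, ← mul_assoc f', ← hz, mul_assoc],
        show k * (z ^ m * aeval p (β' n)) = z ^ m * (k * aeval p (β' n)) by
          rw [← mul_assoc, ← hz, mul_assoc]]
      noncomm_ring
    rw [basisVec, this]
    exact add_mem (add_mem (mul_inc_mem_biIdeal (i := 5) (by decide) _)
      (inc_mul_mem_biIdeal (i := 5) (by decide) _)) (inc_mul_mem_biIdeal (i := 1) (by decide) _)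
  | .mono x hx => exact Submodule.mem_sup_left (pbw_mem_kU hx)

end spanning

/-! ### Linear independence of the basis vectors. -/

section independence

open Classical in
/-- The linear map that inverts `basisVec` on its span. -/
noncomputable def basisVecInv : gl12.U →ₗ[ℂ] BasisIndex →₀ ℂ :=
  pbwBasis.constr ℂ fun x =>
    if h : x.HasK then Finsupp.single (.mono x h) 1
    else if x.s₂ = 0 then
      if x.s₃ = 0 then
        if x.s₁ = 0 then 0 else -Finsupp.single (.beta x.t (x.s₁ - 1)) 1
      else Finsupp.single (.pf x.t x.s₁) 1
    else if x.s₃ = 0 then Finsupp.single (.pe x.t x.s₁) 1 else 0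

/-- The map kills `z^m` and `z^m p^n e f`, so a vector of family (ii) is detected by its term `-z^m
p^(n+1)` alone; the minus sign in `basisVecInv` compensates, and `β'` may be arbitrary. -/
theorem basisVecInv_basisVec (β' : ℕ → ℂ[X]) (i : BasisIndex) :
    basisVecInv (basisVec β' i) = Finsupp.single i 1 := by
  match i with
  | .pe m n =>
    rw [basisVec, ← pbw_e, ← pbwBasis_apply, basisVecInv, Basis.constr_basis]
    simp [PBWExponent.HasK]
  | .pf m n =>
    rw [basisVec, ← pbw_f, ← pbwBasis_apply, basisVecInv, Basis.constr_basis]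
    simp [PBWExponent.HasK]
  | .beta m n =>
    have h0 : basisVecInv (z ^ m * aeval p (β' n) * e * f) = 0 := by
      rw [aeval_eq_sum_range, Finset.mul_sum, Finset.sum_mul, Finset.sum_mul, map_sum]
      refine Finset.sum_eq_zero fun i _ => ?_
      rw [mul_smul_comm, smul_mul_assoc, smul_mul_assoc, map_smul, ← pbw_ef, ← pbwBasis_apply,
        basisVecInv, Basis.constr_basis]
      simp [PBWExponent.HasK]
    rw [basisVec, map_sub, h0, ← pbw_p, ← pbwBasis_apply, basisVecInv, Basis.constr_basis]
    simp [PBWExponent.HasK]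
  | .mono x hx =>
    rw [basisVec, ← pbwBasis_apply, basisVecInv, Basis.constr_basis, dif_pos hx]

theorem linearIndependent_basisVec (β' : ℕ → ℂ[X]) : LinearIndependent ℂ (basisVec β') := by
  refine LinearIndependent.of_comp basisVecInv ?_
  rw [show basisVecInv ∘ basisVec β' = fun i => Finsupp.single i 1 from
    funext (basisVecInv_basisVec β')]
  exact Finsupp.linearIndependent_single_one ℂ BasisIndex

end independence

end GL12

theorem theorem4p9 :
    (∃! αβ : (ℕ → Polynomial ℂ) × (ℕ → Polynomial ℂ), GL12.IsAlphaBeta αβ.1 αβ.2) ∧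
    ∀ α β' : ℕ → Polynomial ℂ, GL12.IsAlphaBeta α β' →
      LinearIndependent ℂ (GL12.basisVec β') ∧
      Submodule.span ℂ (Set.range (GL12.basisVec β')) =
        LieSuperalgebra.biIdeal GL12.osp12 :=
  ⟨GL12.existsUnique_alphaBeta, fun _ β' h => ⟨GL12.linearIndependent_basisVec β',
    (GL12.span_le_biIdeal h).antisymm (GL12.biIdeal_le_span h)⟩⟩
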